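/- Let $0<M<N$ be integers and let $\mathbb K=\mathbb R$ or $\mathbb C$. For fields $u=(u^1,\dots,u^N)$, with values in $U=\{u\in\mathbb K^N : u^i\neq 0 \text{ for all } i\}$, consider the Lax function $\mathcal L=p^{-M}\prod_{i=1}^N(p+u^i)$ and, for $n\ge 1$, the Lax equation $$\frac{\partial\mathcal L}{\partial\tau_n}=\{(\mathcal L^{n/(N-M)})_+,\mathcal L\}_{PB},\qquad \{a,b\}_{PB}=p\,(\partial_p a\,\partial_x b-\partial_x a\,\partial_p b),$$ where $\mathcal L^{n/(N-M)}=p^n\prod_{i}(1+u^i/p)^{n/(N-M)}$ is expanded formally at $p=\infty$ and $(\ )_+$ keeps the powers $p^k$ with $k\ge 0$. Let $Q^{(n)}(u)$ be the coefficient of $p^0$ in this expansion, i.e. $Q^{(n)}=\frac1{2\pi i}\oint\mathcal L^{n/(N-M)}\frac{dp}{p}$, and let $H^{(n)}=\int Q^{(n)}\,dx$. Define $$g^{ii}(u)=[1-(N-M)](u^i)^2,\qquad g^{ij}(u)=u^iu^j\quad(i\ne j).$$ Let $\Gamma^{j}_{sk}$ be the Christoffel symbols of the Levi-Civita connection of the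 inverse matrix of $(g^{ij})$, put $\Gamma^{ij}_k=-\sum_s g^{is}\Gamma^j_{sk}$, and $A^{ij}=g^{ij}(u)\frac{d}{dx}+\sum_k\Gamma^{ij}_k(u)u^k_x$. Then: 1. On $U$ the matrix $(g^{ij})$ is a smooth, symmetric, non-degenerate (contravariant) metric, and its Riemann curvature tensor vanishes. 2. The bracket $\{I,J\}=\int\sum_{i,j}\frac{\delta I}{\delta u^i}A^{ij}\frac{\delta J}{\delta u^j}\,dx$ is a Poisson bracket (closed, skew-symmetric, and satisfying the Jacobi identity) on the functionals with smooth variational derivative of smooth fields $u(x)\in U$ of period $1$ in $x$. 3. For every $n\ge1$ the functional $\frac1n H^{(n)}$ has the variational derivative $\frac1n\,\partial Q^{(n)}/\partial u^j$, and the $n$-th Lax flow is its Hamiltonian flow: for a field $u(\tau_n,x)\in U$ the Hamiltonian equations $$u^i_{\tau_n}=\frac1n\sum_j A^{ij}\,\frac{\delta H^{(n)}}{\delta u^j},\qquad i=1,\dots,N,$$ imply the Lax equation, and, wherever the values $u^1,\dots,u^N$ are pairwise distinct, the Lax equation implies them. -/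

import Mathlib

open scoped ContDiff

noncomputable section

namespace DispersionlessLax

variable {𝕜 : Type*} [RCLike 𝕜] {N : ℕ}

/-! ### Contravariant metrics on an open subset of `𝕜 ^ N` -/

/-- The partial derivative `∂f/∂u^k`. -/
def pd (k : Fin N) (f : (Fin N → 𝕜) → 𝕜) (u : Fin N → 𝕜) : 𝕜 :=
  fderiv 𝕜 f u (Pi.single k 1)

/-- The Christoffel symbol `Γ^k_{ij}` of the Levi-Civita connection of the covariant metric
`g_{ij}`, the inverse matrix of the contravariant metric `g^{ij}`. -/
def christoffel (g : (Fin N → 𝕜) → Matrix (Fin N) (Fin N) 𝕜) (k i j : Fin N)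
    (u : Fin N → 𝕜) : 𝕜 :=
  (1 / 2) * ∑ l, g u k l *
    (pd i (fun v => (g v)⁻¹ l j) u + pd j (fun v => (g v)⁻¹ i l) u
      - pd l (fun v => (g v)⁻¹ i j) u)

/-- The Riemann curvature tensor `R^l_{kij}` of that connection. -/
def riemann (g : (Fin N → 𝕜) → Matrix (Fin N) (Fin N) 𝕜) (l k i j : Fin N)
    (u : Fin N → 𝕜) : 𝕜 :=
  pd i (christoffel g l j k) u - pd j (christoffel g l i k) u
    + ∑ m, (christoffel g l i m u * christoffel g m j k u
      - christoffel g l j m u * christoffel g m i k u)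

/-- `g^{ij}` is a smooth, symmetric, non-degenerate, flat (contravariant) metric on `U`. -/
structure IsFlatMetric (g : (Fin N → 𝕜) → Matrix (Fin N) (Fin N) 𝕜)
    (U : Set (Fin N → 𝕜)) : Prop where
  smooth : ∀ i j, ContDiffOn 𝕜 ∞ (fun u => g u i j) U
  symm : ∀ u ∈ U, ∀ i j, g u i j = g u j i
  nondegenerate : ∀ u ∈ U, (g u).det ≠ 0
  flat : ∀ u ∈ U, ∀ l k i j, riemann g l k i j u = 0

/-- The contravariant connection coefficients `Γ^{ij}_k = - g^{is} Γ^j_{sk}`. -/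
def contraGamma (g : (Fin N → 𝕜) → Matrix (Fin N) (Fin N) 𝕜) (i j k : Fin N)
    (u : Fin N → 𝕜) : 𝕜 :=
  -∑ s, g u i s * christoffel g j s k u

/-- The first order operator of the metric `g` at the field `u`, applied to a covector field `ξ`:
`(A[u] ξ)^i = g^{ij}(u) dξ_j/dx + Γ^{ij}_k(u) u^k_x ξ_j`. -/
def hydroOp (g : (Fin N → 𝕜) → Matrix (Fin N) (Fin N) 𝕜) (u ξ : ℝ → Fin N → 𝕜)
    (x : ℝ) (i : Fin N) : 𝕜 :=
  ∑ j, (g (u x) i j * deriv (fun y => ξ y j) x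
    + ∑ k, contraGamma g i j k (u x) * deriv (fun y => u y k) x * ξ x j)

/-! ### Functionals of periodic fields and the Poisson bracket of hydrodynamic type -/

/-- Smooth fields `u(x)` of period `1` with values in `U`. -/
def Loop (U : Set (Fin N → 𝕜)) : Type _ :=
  {u : ℝ → Fin N → 𝕜 // ContDiff ℝ ∞ u ∧ Function.Periodic u 1 ∧ ∀ x, u x ∈ U}

/-- `δF` is the variational derivative `δF/δu^i(x)` of the functional `F`: it is periodic, depends
smoothly on the field (smooth finite-dimensional families of fields go to smooth families), and
`d/ds F[u_s] = ∫ ∑_i δF/δu^i(x) ∂_s u_s^i(x) dx` along every smooth curve `s ↦ u_s` of fields. -/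
structure IsVarDeriv {U : Set (Fin N → 𝕜)} (F : Loop U → 𝕜)
    (δF : Loop U → ℝ → Fin N → 𝕜) : Prop where
  periodic : ∀ u, Function.Periodic (δF u) 1
  smooth : ∀ (m : ℕ) (w : (Fin m → ℝ) → Loop U),
    ContDiff ℝ ∞ (fun q : (Fin m → ℝ) × ℝ => (w q.1).1 q.2) →
    ContDiff ℝ ∞ (fun q : (Fin m → ℝ) × ℝ => δF (w q.1) q.2)
  variation : ∀ w : ℝ → Loop U, ContDiff ℝ ∞ (fun q : ℝ × ℝ => (w q.1).1 q.2) →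
    ∀ s : ℝ, HasDerivAt (fun r => F (w r))
      (∫ x in (0 : ℝ)..1, ∑ i, δF (w s) x i * deriv (fun r => (w r).1 x i) s) s

/-- The bracket `{F, G}[u] = ∫ δF/δu^i A^{ij}[u] δG/δu^j dx`, in terms of the variational
derivatives of `F` and `G`. -/
def bracket {U : Set (Fin N → 𝕜)} (g : (Fin N → 𝕜) → Matrix (Fin N) (Fin N) 𝕜)
    (δF δG : Loop U → ℝ → Fin N → 𝕜) (u : Loop U) : 𝕜 :=
  ∫ x in (0 : ℝ)..1, ∑ i, δF u x i * hydroOp g u.1 (δG u) x i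

/-- The bracket of the metric `g` is a Poisson bracket on the functionals (with smooth variational
derivative) of fields in `U`: it is a functional of the same kind, it is skew-symmetric, and it
satisfies the Jacobi identity. It is a derivation in each argument by its form. -/
structure IsHamiltonianStructure (g : (Fin N → 𝕜) → Matrix (Fin N) (Fin N) 𝕜)
    (U : Set (Fin N → 𝕜)) : Prop where
  closed : ∀ (F G : Loop U → 𝕜) (δF δG : Loop U → ℝ → Fin N → 𝕜),
    IsVarDeriv F δF → IsVarDeriv G δG → ∃ δK, IsVarDeriv (bracket g δF δG) δK
  skew : ∀ (F G : Loop U → 𝕜) (δF δG : Loop U → ℝ → Fin N → 𝕜),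
    IsVarDeriv F δF → IsVarDeriv G δG → ∀ u, bracket g δF δG u = -bracket g δG δF u
  jacobi : ∀ (F G H : Loop U → 𝕜) (δF δG δH δFG δGH δHF : Loop U → ℝ → Fin N → 𝕜),
    IsVarDeriv F δF → IsVarDeriv G δG → IsVarDeriv H δH →
    IsVarDeriv (bracket g δF δG) δFG → IsVarDeriv (bracket g δG δH) δGH →
    IsVarDeriv (bracket g δH δF) δHF →
    ∀ u, bracket g δFG δH u + bracket g δGH δF u + bracket g δHF δG u = 0

/-! ### The Lax function, its fractional powers and the Lax equation -/

/-- The Lax function `L = p^{-M} ∏_i (p + u^i)`. -/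
def lax (M : ℕ) (u : Fin N → 𝕜) (p : 𝕜) : 𝕜 :=
  (p ^ M)⁻¹ * ∏ i, (p + u i)

/-- Since `L = p^{N-M} ∏_i (1 + u^i p⁻¹)`, the expansion of `L^{n/(N-M)}` at `p = ∞` is
`p^n S(p⁻¹)`, where `S(X) = ∏_i (1 + u^i X)^{n/(N-M)}` is a product of binomial series. -/
def powSeries (M n : ℕ) (u : Fin N → 𝕜) : PowerSeries 𝕜 :=
  ∏ i, PowerSeries.rescale (u i)
    (PowerSeries.binomialSeries 𝕜 ((n : ℚ) / ((N : ℚ) - (M : ℚ))))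

/-- `powSeries` is the `n/(N-M)`-th power of `∏_i (1 + u^i X)`. -/
theorem powSeries_pow {M : ℕ} (h : M < N) (n : ℕ) (u : Fin N → 𝕜) :
    powSeries M n u ^ (N - M) =
      (∏ i, (1 + PowerSeries.C (u i) * PowerSeries.X)) ^ n := by
  have hne : ((N : ℚ) - (M : ℚ)) ≠ 0 := by
    have : (M : ℚ) < N := by exact_mod_cast h
    linarith
  have hpow : ∀ (q : ℚ) (k : ℕ), PowerSeries.binomialSeries 𝕜 q ^ k =
      PowerSeries.binomialSeries 𝕜 ((k : ℚ) * q) := by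
    intro q k
    induction k with
    | zero => simp
    | succ k ih =>
      rw [pow_succ, ih, ← PowerSeries.binomialSeries_add]
      congr 1
      push_cast
      ring
  have hq : (((N - M : ℕ) : ℚ)) * ((n : ℚ) / ((N : ℚ) - (M : ℚ))) = (n : ℚ) := by
    rw [Nat.cast_sub h.le]
    field_simp
  unfold powSeries
  rw [← Finset.prod_pow, ← Finset.prod_pow]
  refine Finset.prod_congr rfl fun i _ => ?_
  rw [← map_pow, hpow, hq, PowerSeries.binomialSeries_nat, map_pow, map_add, map_one,
    PowerSeries.rescale_X]

/-- `(L^{n/(N-M)})_+`, the part of the expansion with non-negative powers of `p`. -/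
def powPlus (M n : ℕ) (u : Fin N → 𝕜) (p : 𝕜) : 𝕜 :=
  ∑ r ∈ Finset.range (n + 1), PowerSeries.coeff r (powSeries M n u) * p ^ (n - r)

/-- The density `Q^{(n)} = (2πi)⁻¹ ∮ L^{n/(N-M)} dp/p`: the coefficient of `p^0`. -/
def chargeDensity (M n : ℕ) (u : Fin N → 𝕜) : 𝕜 :=
  PowerSeries.coeff n (powSeries M n u)

/-- The charge `H^{(n)}[u] = ∫ Q^{(n)}(u(x)) dx`. -/
def charge (M n : ℕ) {U : Set (Fin N → 𝕜)} (u : Loop U) : 𝕜 :=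
  ∫ x in (0 : ℝ)..1, chargeDensity M n (u.1 x)

/-- The bracket `{a, b} = p (∂_p a ∂_x b - ∂_x a ∂_p b)` of functions of `(p, x)`. -/
def pbPX (a b : 𝕜 → ℝ → 𝕜) (p : 𝕜) (x : ℝ) : 𝕜 :=
  p * (deriv (fun q => a q x) p * deriv (fun y => b p y) x
    - deriv (fun y => a p y) x * deriv (fun q => b q x) p)

/-- The Lax equation `∂L/∂τ_n = {(L^{n/(N-M)})_+, L}` for `u = u(τ, x)` at the point `(τ, x)`,
as an identity in `p`. -/
def LaxEqAt (M n : ℕ) (u : ℝ → ℝ → Fin N → 𝕜) (τ x : ℝ) : Prop :=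
  ∀ p : 𝕜, p ≠ 0 →
    deriv (fun σ => lax M (u σ x) p) τ =
      pbPX (fun q y => powPlus M n (u τ y) q) (fun q y => lax M (u τ y) q) p x

/-- The Hamiltonian equation `u^i_τ = A^{ij}[u] ξ_j` at `(τ, x)`, where the covector field
`ξ` is the variational derivative of the Hamiltonian. -/
def HamEqAt (g : (Fin N → 𝕜) → Matrix (Fin N) (Fin N) 𝕜) (ξ : (ℝ → Fin N → 𝕜) → ℝ → Fin N → 𝕜)
    (u : ℝ → ℝ → Fin N → 𝕜) (τ x : ℝ) : Prop :=
  ∀ i, deriv (fun σ => u σ x i) τ = hydroOp g (u τ) (ξ (u τ)) x i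

/-! ### The metric of the hierarchy -/

/-- The domain where all `u^i` are non-zero. -/
def nonzeroDomain (𝕜 : Type*) [RCLike 𝕜] (N : ℕ) : Set (Fin N → 𝕜) := {u | ∀ i, u i ≠ 0}

/-- `g^{ii} = (1 - (N - M)) (u^i)^2` and `g^{ij} = u^i u^j` for `i ≠ j`. -/
def laxMetric (M : ℕ) (u : Fin N → 𝕜) : Matrix (Fin N) (Fin N) 𝕜 :=
  Matrix.of fun i j =>
    if i = j then (1 - ((N : 𝕜) - (M : 𝕜))) * u i * u i else u i * u j

/-- The variational derivative of `n⁻¹ H^{(n)}`: the `j`-th component is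
`n⁻¹ ∂Q^{(n)}/∂u^j (u(x))`. -/
def chargeGrad (M n : ℕ) (u : ℝ → Fin N → 𝕜) (x : ℝ) (j : Fin N) : 𝕜 :=
  (n : 𝕜)⁻¹ * pd j (chargeDensity M n) (u x)

end DispersionlessLax

end

open DispersionlessLax

noncomputable section

namespace DispersionlessLax

variable {𝕜 : Type*} [RCLike 𝕜] {N : ℕ}

/-! Everything becomes simple in the coordinates `log u^i`. There the metric has the constant
components `η^{ij} = 1 - (N-M) δ^{ij}` (`logMetric`), and `A = u^i η^{ij} (d/dx) u^j`
(`hydroOp_laxMetric`). Flatness follows. The bracket becomes `∫ a_i η^{ij} ∂_x b_j`, where `a`, `b`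
are the gradients with respect to `log u` (`bracket_eq_pairing`). It is skew by integration by parts
(`pairing_op`), and the Jacobi identity reduces to the symmetry of second variations
(`IsVarDeriv.pairing_deriv_logGrad`). A loop in `U` need not have a periodic logarithm, so no
logarithm is ever taken: loops are varied multiplicatively, `u ↦ u exp(tψ)`.

For the Lax equation, put `B(p) = (L^{n/(N-M)})_+` and `α = n/(N-M)`. The series `S = ∏ (1 + u^i
X)^α` satisfies `(1 + u^i X) ∂_i S = α X S`. Truncation spoils this only by a term constant in `p`,
so `(p + u^i) ∂_i B(p) = α (B(p) - B(-u^i))` (`add_mul_revPoly_pd`). Differentiating this in `x` and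
in `p`, and using homogeneity, gives `{B, L} / L = ∑ u^i ∂_x[B(-u^i)] / (p + u^i)`, with
denominators cleared in `sum_powPlusAtRoot_identity`. Since `∂_τ L / L = ∑ u^i_τ / (p + u^i)`, the
Lax equation is a combination of the equations `u^i_τ = u^i ∂_x[B(-u^i)]`, and it separates into
them when the `u^i` are distinct. The Hamiltonian equations are exactly these, because `∑_j η^{ij}
u^j ∂_j Q / n = B(-u^i)` by Euler's identity (`sum_logMetric_mul_pd_chargeDensity`). -/

/-! ### The metric in logarithmic coordinates -/

/-- The constant components of the metric in the coordinates `log u^i`. -/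
def logMetric (𝕜 : Type*) [RCLike 𝕜] (N M : ℕ) (i j : Fin N) : 𝕜 :=
  1 - ((N : 𝕜) - (M : 𝕜)) * if i = j then 1 else 0

theorem logMetric_comm (M : ℕ) (i j : Fin N) : logMetric 𝕜 N M i j = logMetric 𝕜 N M j i := by
  simp [logMetric, eq_comm]

theorem sum_logMetric_mul (M : ℕ) (i : Fin N) (f : Fin N → 𝕜) :
    ∑ j, logMetric 𝕜 N M i j * f j = (∑ j, f j) - ((N : 𝕜) - (M : 𝕜)) * f i := by
  simp [logMetric, sub_mul, Finset.sum_sub_distrib]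

theorem laxMetric_apply (M : ℕ) (u : Fin N → 𝕜) (i j : Fin N) :
    laxMetric M u i j = u i * u j * logMetric 𝕜 N M i j := by
  unfold laxMetric logMetric
  rw [Matrix.of_apply]
  split_ifs with h
  · subst h; ring
  · ring

theorem isOpen_nonzeroDomain : IsOpen (nonzeroDomain 𝕜 N) := by
  have : nonzeroDomain 𝕜 N = ⋂ i, {u : Fin N → 𝕜 | u i ≠ 0} := by
    ext u; simp [nonzeroDomain]
  rw [this]
  exact isOpen_iInter_of_finite fun i => isOpen_ne_fun (continuous_apply i) continuous_const

/-- The inverse matrix of `laxMetric`. -/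
def laxCometric (M : ℕ) (u : Fin N → 𝕜) : Matrix (Fin N) (Fin N) 𝕜 :=
  Matrix.of fun i j =>
    -((N : 𝕜) - (M : 𝕜))⁻¹ * ((if i = j then 1 else 0) - (M : 𝕜)⁻¹) * ((u i)⁻¹ * (u j)⁻¹)

theorem laxCometric_comm (M : ℕ) (u : Fin N → 𝕜) (i j : Fin N) :
    laxCometric M u i j = laxCometric M u j i := by
  simp only [laxCometric, Matrix.of_apply, eq_comm (a := i)]
  ring

theorem natCast_sub_ne_zero {M : ℕ} (h : M < N) : ((N : 𝕜) - (M : 𝕜)) ≠ 0 :=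
  sub_ne_zero.2 fun e => h.ne' (Nat.cast_injective e)

/-- After the factors `u` are removed, this inverts `J - (N-M)·1`, where `J` is the all-ones matrix.
Since `J² = N J`, the inverse is `-(N-M)⁻¹ (1 - M⁻¹ J)`; both `M ≠ 0` and `M ≠ N` are needed. -/
theorem laxMetric_mul_laxCometric {M : ℕ} (hM : 0 < M) (h : M < N) {u : Fin N → 𝕜}
    (hu : u ∈ nonzeroDomain 𝕜 N) : laxMetric M u * laxCometric M u = 1 := by
  have hd := natCast_sub_ne_zero (𝕜 := 𝕜) h
  have hM' : (M : 𝕜) ≠ 0 := Nat.cast_ne_zero.2 hM.ne'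
  ext i k
  have hi := hu i
  have hk := hu k
  have key : ∀ j, laxMetric M u i j * laxCometric M u j k =
      logMetric 𝕜 N M i j * (-((N : 𝕜) - (M : 𝕜))⁻¹ * u i * (u k)⁻¹ *
        ((if j = k then 1 else 0) - (M : 𝕜)⁻¹)) := by
    intro j
    have hj := hu j
    rw [laxMetric_apply, laxCometric, Matrix.of_apply]
    field_simp
  rw [Matrix.mul_apply, Finset.sum_congr rfl fun j _ => key j, sum_logMetric_mul,
    ← Finset.mul_sum, Finset.sum_sub_distrib, Matrix.one_apply]
  simp only [Finset.sum_ite_eq', Finset.mem_univ, if_true, Finset.sum_const, Finset.card_univ,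
    Fintype.card_fin, nsmul_eq_mul]
  split_ifs with hik
  · subst hik
    field_simp
    ring
  · field_simp
    ring

theorem laxMetric_inv {M : ℕ} (hM : 0 < M) (h : M < N) {u : Fin N → 𝕜}
    (hu : u ∈ nonzeroDomain 𝕜 N) : (laxMetric M u)⁻¹ = laxCometric M u :=
  Matrix.inv_eq_right_inv (laxMetric_mul_laxCometric hM h hu)

theorem pd_congr {f g : (Fin N → 𝕜) → 𝕜} {u : Fin N → 𝕜} (h : f =ᶠ[nhds u] g) (k : Fin N) :
    pd k f u = pd k g u := by
  simp only [pd, h.fderiv_eq]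

theorem pd_laxCometric (M : ℕ) {u : Fin N → 𝕜} (hu : u ∈ nonzeroDomain 𝕜 N) (i l j : Fin N) :
    pd i (fun v => laxCometric M v l j) u =
      -laxCometric M u l j * ((if i = l then (u i)⁻¹ else 0) + if i = j then (u i)⁻¹ else 0) := by
  have hinv : ∀ m, HasFDerivAt (𝕜 := 𝕜) (fun v : Fin N → 𝕜 => (v m)⁻¹)
      (-(u m ^ 2)⁻¹ • ContinuousLinearMap.proj (R := 𝕜) (φ := fun _ : Fin N => 𝕜) m) u :=
    fun m => (hasDerivAt_inv (hu m)).comp_hasFDerivAt u (hasFDerivAt_apply m u)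
  have hd : pd i (fun v => laxCometric M v l j) u =
      (-((N : 𝕜) - (M : 𝕜))⁻¹ * ((if l = j then 1 else 0) - (M : 𝕜)⁻¹)) *
        ((u l)⁻¹ * (-(u j ^ 2)⁻¹ * (Pi.single i 1 : Fin N → 𝕜) j)
          + (u j)⁻¹ * (-(u l ^ 2)⁻¹ * (Pi.single i 1 : Fin N → 𝕜) l)) := by
    have := (((hinv l).mul (hinv j)).const_mul
      (-((N : 𝕜) - (M : 𝕜))⁻¹ * ((if l = j then 1 else 0) - (M : 𝕜)⁻¹))).fderiv
    exact congrArg (fun T : (Fin N → 𝕜) →L[𝕜] 𝕜 => T (Pi.single i 1)) this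
  have h1 : ∀ m, (u m ^ 2)⁻¹ * (Pi.single i 1 : Fin N → 𝕜) m =
      (u m)⁻¹ * if i = m then (u i)⁻¹ else 0 := by
    intro m
    by_cases him : i = m
    · subst him
      simp [pow_two]
    · simp [him, Ne.symm him]
  have h2 : laxCometric M u l j =
      -((N : 𝕜) - (M : 𝕜))⁻¹ * ((if l = j then 1 else 0) - (M : 𝕜)⁻¹) * ((u l)⁻¹ * (u j)⁻¹) :=
    rfl
  rw [hd, h2]
  linear_combination ((N : 𝕜) - (M : 𝕜))⁻¹ * ((if l = j then 1 else 0) - (M : 𝕜)⁻¹) *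
    ((u l)⁻¹ * h1 j + (u j)⁻¹ * h1 l)

theorem christoffel_laxMetric {M : ℕ} (hM : 0 < M) (h : M < N) {u : Fin N → 𝕜}
    (hu : u ∈ nonzeroDomain 𝕜 N) (k i j : Fin N) :
    christoffel (laxMetric M) k i j u = if i = j ∧ k = j then -(u j)⁻¹ else 0 := by
  have hev : ∀ a b, (fun v => (laxMetric M v)⁻¹ a b) =ᶠ[nhds u] fun v => laxCometric M v a b :=
    fun a b => by
      filter_upwards [isOpen_nonzeroDomain.mem_nhds hu] with v hv
      rw [laxMetric_inv hM h hv]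
  have hmul : ∑ l, laxMetric M u k l * laxCometric M u l j = if k = j then 1 else 0 := by
    rw [← Matrix.mul_apply, laxMetric_mul_laxCometric hM h hu, Matrix.one_apply]
  unfold christoffel
  simp only [pd_congr (hev _ _), pd_laxCometric M hu]
  -- The `δ_{il}` and `δ_{jl}` parts of the first two derivatives cancel against `∂_l g_{ij}`. What
  -- remains lives on `i = j` and carries the factor `g_{lj}`, so the sum over `l` contracts to
  -- `δ^k_j`.
  have : ∀ l, laxMetric M u k l *
      (-laxCometric M u l j * ((if i = l then (u i)⁻¹ else 0) + if i = j then (u i)⁻¹ else 0)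
      + -laxCometric M u i l * ((if j = i then (u j)⁻¹ else 0) + if j = l then (u j)⁻¹ else 0)
      - -laxCometric M u i j * ((if l = i then (u l)⁻¹ else 0) + if l = j then (u l)⁻¹ else 0))
      = (if i = j then -2 * (u j)⁻¹ else 0) * (laxMetric M u k l * laxCometric M u l j) := by
    intro l
    have e1 : laxCometric M u i j * (if l = i then (u l)⁻¹ else 0) =
        laxCometric M u l j * if i = l then (u i)⁻¹ else 0 := by
      by_cases hil : i = l
      · subst hil; rfl
      · simp [hil, Ne.symm hil]
    have e2 : laxCometric M u i j * (if l = j then (u l)⁻¹ else 0) =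
        laxCometric M u i l * if j = l then (u j)⁻¹ else 0 := by
      by_cases hjl : j = l
      · subst hjl; rfl
      · simp [hjl, Ne.symm hjl]
    have e3 : laxCometric M u l j * (if i = j then (u i)⁻¹ else 0) +
        laxCometric M u i l * (if j = i then (u j)⁻¹ else 0) =
        2 * laxCometric M u l j * if i = j then (u j)⁻¹ else 0 := by
      by_cases hij : i = j
      · subst hij
        rw [laxCometric_comm M u i l]
        ring
      · simp [hij, Ne.symm hij]
    have e4 : (if i = j then -2 * (u j)⁻¹ else 0) = -2 * if i = j then (u j)⁻¹ else 0 := by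
      split_ifs <;> simp
    rw [e4]
    linear_combination laxMetric M u k l * (e1 + e2 - e3)
  rw [Finset.sum_congr rfl fun l _ => this l, ← Finset.mul_sum, hmul]
  split_ifs <;> simp_all

/-- The only non-zero Christoffel symbols are `Γ^l_{ll} = -1/u^l`, each a function of its own
variable alone. Hence the derivative part and the quadratic part of the curvature vanish separately.
-/
theorem isFlatMetric_laxMetric {M : ℕ} (hM : 0 < M) (h : M < N) :
    IsFlatMetric (laxMetric (𝕜 := 𝕜) (N := N) M) (nonzeroDomain 𝕜 N) where
  smooth i j := by
    simp only [laxMetric_apply]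
    exact (((contDiff_apply 𝕜 𝕜 i).mul (contDiff_apply 𝕜 𝕜 j)).mul contDiff_const).contDiffOn
  symm u _ i j := by
    rw [laxMetric_apply, laxMetric_apply, logMetric_comm]
    ring
  nondegenerate u hu :=
    (Matrix.isUnit_det_of_right_inverse (laxMetric_mul_laxCometric hM h hu)).ne_zero
  flat u hu l k i j := by
    have hev : ∀ a b c, christoffel (laxMetric (𝕜 := 𝕜) M) a b c =ᶠ[nhds u]
        fun v => if b = c ∧ a = c then -(v c)⁻¹ else 0 := fun a b c => by
      filter_upwards [isOpen_nonzeroDomain.mem_nhds hu] with v hv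
      rw [christoffel_laxMetric hM h hv]
    have hpd : ∀ a (b : Fin N), a ≠ b → pd a (fun v : Fin N → 𝕜 => -(v b)⁻¹) u = 0 := by
      intro a b hab
      have hp : HasFDerivAt (𝕜 := 𝕜) (fun v : Fin N → 𝕜 => v b)
          (ContinuousLinearMap.proj (R := 𝕜) (φ := fun _ : Fin N => 𝕜) b) u :=
        hasFDerivAt_apply b u
      have := ((hasDerivAt_inv (hu b)).neg).comp_hasFDerivAt u hp
      unfold pd
      erw [this.fderiv]
      simp [hab.symm]
    have hpd0 : ∀ a, pd a (fun _ : Fin N → 𝕜 => (0 : 𝕜)) u = 0 := fun a => by simp [pd]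
    have hsum : ∑ m, (christoffel (laxMetric M) l i m u * christoffel (laxMetric M) m j k u
        - christoffel (laxMetric M) l j m u * christoffel (laxMetric M) m i k u) = 0 := by
      refine Finset.sum_eq_zero fun m _ => ?_
      simp only [christoffel_laxMetric hM h hu]
      by_cases h1 : i = m <;> by_cases h2 : j = m <;> by_cases h3 : m = k <;> simp_all
    unfold riemann
    rw [hsum, pd_congr (hev l j k), pd_congr (hev l i k)]
    by_cases hlk : l = k
    · subst hlk
      by_cases hj : j = l <;> by_cases hi : i = l <;> simp_all
    · simp [hlk, hpd0]

theorem contraGamma_laxMetric {M : ℕ} (hM : 0 < M) (h : M < N) {u : Fin N → 𝕜}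
    (hu : u ∈ nonzeroDomain 𝕜 N) (i j k : Fin N) :
    contraGamma (laxMetric M) i j k u = if j = k then laxMetric M u i j * (u j)⁻¹ else 0 := by
  unfold contraGamma
  simp only [christoffel_laxMetric hM h hu]
  by_cases hjk : j = k
  · subst hjk
    simp
  · simp [hjk]

/-- In logarithmic coordinates the operator of the metric has constant coefficients. -/
theorem hydroOp_laxMetric {M : ℕ} (hM : 0 < M) (h : M < N) {u ξ : ℝ → Fin N → 𝕜} {x : ℝ}
    (hux : u x ∈ nonzeroDomain 𝕜 N) (hu : ∀ j, DifferentiableAt ℝ (fun y => u y j) x)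
    (hξ : ∀ j, DifferentiableAt ℝ (fun y => ξ y j) x) (i : Fin N) :
    hydroOp (laxMetric M) u ξ x i =
      u x i * ∑ j, logMetric 𝕜 N M i j * deriv (fun y => u y j * ξ y j) x := by
  unfold hydroOp
  rw [Finset.mul_sum]
  refine Finset.sum_congr rfl fun j _ => ?_
  have hj := hux j
  rw [deriv_fun_mul (hu j) (hξ j)]
  simp only [contraGamma_laxMetric hM h hux, ite_mul, zero_mul, Finset.sum_ite_eq,
    Finset.mem_univ, if_true, laxMetric_apply]
  field_simp
  ring

/-! ### Partial derivatives -/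

theorem fderiv_apply_eq_sum_pd (f : (Fin N → 𝕜) → 𝕜) (u h : Fin N → 𝕜) :
    fderiv 𝕜 f u h = ∑ j, h j * pd j f u := by
  unfold pd
  conv_lhs => rw [pi_eq_sum_univ' h]
  rw [map_sum]
  refine Finset.sum_congr rfl fun j _ => ?_
  rw [map_smul, smul_eq_mul]

theorem contDiff_pd {f : (Fin N → 𝕜) → 𝕜} (hf : ContDiff 𝕜 ∞ f) (j : Fin N) :
    ContDiff 𝕜 ∞ (pd j f) :=
  (hf.fderiv_right (m := ∞) (by simp)).clm_apply contDiff_const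

theorem hasDerivAt_update_pd {f : (Fin N → 𝕜) → 𝕜} {u : Fin N → 𝕜}
    (hf : DifferentiableAt 𝕜 f u) (j : Fin N) :
    HasDerivAt (fun t => f (Function.update u j t)) (pd j f u) (u j) := by
  have h1 : HasDerivAt (Function.update u j) (Pi.single j 1) (u j) := hasDerivAt_update u j (u j)
  have h2 : HasFDerivAt f (fderiv 𝕜 f u) (Function.update u j (u j)) := by
    rw [Function.update_eq_self]
    exact hf.hasFDerivAt
  exact h2.comp_hasDerivAt (u j) h1

/-! ### Coefficients of the fractional powers -/

/-- Coefficient form of the equation `(1 + X) φ' = q φ` for `φ = (1 + X)^q`. -/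
theorem coeff_binomialSeries_succ (q : ℚ) (k : ℕ) :
    ((k : 𝕜) + 1) * PowerSeries.coeff (k + 1) (PowerSeries.binomialSeries 𝕜 q) +
      k * PowerSeries.coeff k (PowerSeries.binomialSeries 𝕜 q) =
    (q : 𝕜) * PowerSeries.coeff k (PowerSeries.binomialSeries 𝕜 q) := by
  have h : ((k : ℚ) + 1) * Ring.choose q (k + 1) = Ring.choose q k * (q - k) := by
    have := Ring.choose_smul_choose q (Nat.le_succ k)
    simpa [Nat.choose_succ_self_right] using this
  have h' := congrArg (fun r : ℚ => (r : 𝕜)) h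
  push_cast at h'
  simp only [PowerSeries.binomialSeries_coeff, Rat.smul_def, mul_one]
  linear_combination h'

/-- The exponent `n / (N - M)`. -/
def laxExponent (𝕜 : Type*) [RCLike 𝕜] (N M n : ℕ) : 𝕜 := (n : 𝕜) / ((N : 𝕜) - (M : 𝕜))

/-- The coefficients of `powSeries`. -/
def powCoeff (M n r : ℕ) (u : Fin N → 𝕜) : 𝕜 := PowerSeries.coeff r (powSeries M n u)

theorem contDiff_powCoeff (M n r : ℕ) : ContDiff 𝕜 ∞ (powCoeff (𝕜 := 𝕜) (N := N) M n r) := by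
  unfold powCoeff powSeries
  simp only [PowerSeries.coeff_prod, PowerSeries.coeff_rescale]
  refine ContDiff.sum fun l _ => contDiff_prod fun i _ => ?_
  exact ((contDiff_apply 𝕜 𝕜 i).pow _).mul contDiff_const

theorem differentiable_powCoeff (M n r : ℕ) :
    Differentiable 𝕜 (powCoeff (𝕜 := 𝕜) (N := N) M n r) :=
  (contDiff_powCoeff M n r).differentiable (by simp)

theorem powCoeff_smul (M n r : ℕ) (t : 𝕜) (u : Fin N → 𝕜) :
    powCoeff M n r (t • u) = t ^ r * powCoeff M n r u := by
  unfold powCoeff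
  rw [← PowerSeries.coeff_rescale, powSeries, powSeries,
    map_prod (PowerSeries.rescale t)]
  simp only [Pi.smul_apply, smul_eq_mul, PowerSeries.rescale_rescale]
  simp only [mul_comm t]

/-- Euler's identity: the scaling law `powCoeff_smul` is differentiated at `t = 1`. -/
theorem sum_mul_pd_powCoeff (M n r : ℕ) (u : Fin N → 𝕜) :
    ∑ i, u i * pd i (powCoeff M n r) u = r * powCoeff M n r u := by
  rw [← fderiv_apply_eq_sum_pd]
  have h1 : HasDerivAt (fun t : 𝕜 => t • u) ((1 : 𝕜) • u) 1 := (hasDerivAt_id 1).smul_const u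
  have h2 : HasFDerivAt (powCoeff M n r) (fderiv 𝕜 (powCoeff M n r) u) ((1 : 𝕜) • u) := by
    rw [one_smul]
    exact (differentiable_powCoeff M n r u).hasFDerivAt
  have h3 := h2.comp_hasDerivAt 1 h1
  rw [one_smul] at h3
  have h4 : HasDerivAt (fun t : 𝕜 => t ^ r * powCoeff M n r u)
      ((r * (1 : 𝕜) ^ (r - 1)) * powCoeff M n r u) 1 := (hasDerivAt_pow r 1).mul_const _
  have h5 : (powCoeff M n r ∘ fun t : 𝕜 => t • u) = fun t : 𝕜 => t ^ r * powCoeff M n r u :=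
    funext fun t => powCoeff_smul M n r t u
  rw [h5] at h3
  simpa using h3.unique h4

/-- `(1 + u^j X) ∂S/∂u^j = α X S`, in terms of coefficients. -/
theorem pd_powCoeff (M n : ℕ) (j : Fin N) (u : Fin N → 𝕜) :
    pd j (powCoeff M n 0) u = 0 ∧ ∀ r, pd j (powCoeff M n (r + 1)) u +
      u j * pd j (powCoeff M n r) u = laxExponent 𝕜 N M n * powCoeff M n r u := by
  set q : ℚ := (n : ℚ) / ((N : ℚ) - (M : ℚ)) with hq
  set φ := PowerSeries.binomialSeries 𝕜 q with hφ
  set T : PowerSeries 𝕜 := ∏ i ∈ Finset.univ.erase j, PowerSeries.rescale (u i) φ with hT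
  -- `G` is the termwise derivative of the `j`-th factor in `u^j`, while `T` does not involve `u^j`.
  -- At `a = 0` the truncated exponent `a - 1` is harmless, as the factor `a` vanishes.
  set G : PowerSeries 𝕜 := PowerSeries.mk fun a =>
    (a * (u j) ^ (a - 1)) * PowerSeries.coeff a φ with hG
  have hS : ∀ t, powSeries M n (Function.update u j t) = PowerSeries.rescale t φ * T := by
    intro t
    unfold powSeries
    rw [← Finset.mul_prod_erase _ _ (Finset.mem_univ j), Function.update_self]
    congr 1
    refine Finset.prod_congr rfl fun i hi => ?_
    rw [Function.update_of_ne (Finset.ne_of_mem_erase hi)]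
  have hSu : powSeries M n u = PowerSeries.rescale (u j) φ * T := by
    rw [← hS, Function.update_eq_self]
  have hpd : ∀ r, pd j (powCoeff M n r) u = PowerSeries.coeff r (G * T) := by
    intro r
    refine (hasDerivAt_update_pd (differentiable_powCoeff M n r u) j).unique ?_
    unfold powCoeff
    simp only [hS, PowerSeries.coeff_mul, PowerSeries.coeff_rescale]
    refine HasDerivAt.fun_sum fun a _ => ?_
    rw [hG, PowerSeries.coeff_mk]
    exact ((hasDerivAt_pow a.1 (u j)).mul_const _).mul_const _
  have hα : (q : 𝕜) = laxExponent 𝕜 N M n := by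
    rw [hq, laxExponent]
    push_cast
    rfl
  have hode : (1 + PowerSeries.C (u j) * PowerSeries.X) * G =
      PowerSeries.C (q : 𝕜) * PowerSeries.X * PowerSeries.rescale (u j) φ := by
    ext a
    rw [add_mul, one_mul, mul_assoc, mul_assoc, map_add, PowerSeries.coeff_C_mul,
      PowerSeries.coeff_C_mul]
    cases a with
    | zero => simp [hG]
    | succ a =>
      rw [PowerSeries.coeff_succ_X_mul, PowerSeries.coeff_succ_X_mul, PowerSeries.coeff_rescale,
        hG, PowerSeries.coeff_mk, PowerSeries.coeff_mk]
      have := coeff_binomialSeries_succ (𝕜 := 𝕜) q a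
      rw [← hφ] at this
      cases a with
      | zero =>
        simp only [Nat.cast_zero, zero_add, zero_mul, add_zero, one_mul] at this
        simp [this]
      | succ a =>
        simp only [Nat.add_sub_cancel]
        push_cast at this ⊢
        linear_combination (u j) ^ (a + 1) * this
  have hGT : (1 + PowerSeries.C (u j) * PowerSeries.X) * (G * T) =
      PowerSeries.C (q : 𝕜) * PowerSeries.X * powSeries M n u := by
    rw [← mul_assoc, hode, hSu, mul_assoc]
  constructor
  · rw [hpd]
    simp [hG, PowerSeries.coeff_mul]
  · intro r
    have := congrArg (PowerSeries.coeff (r + 1)) hGT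
    rw [add_mul, one_mul, mul_assoc, mul_assoc, map_add, PowerSeries.coeff_C_mul,
      PowerSeries.coeff_C_mul, PowerSeries.coeff_succ_X_mul, PowerSeries.coeff_succ_X_mul, hα]
      at this
    rw [hpd, hpd]
    exact this

/-! ### The key identity between the Lax function and its fractional powers -/

/-- The polynomial `∑_{r ≤ n} c_r p^{n-r}`. -/
def revPoly (n : ℕ) (c : ℕ → 𝕜) (p : 𝕜) : 𝕜 := ∑ r ∈ Finset.range (n + 1), c r * p ^ (n - r)

/-- The derivative of `revPoly`. -/
def revPolyDeriv (n : ℕ) (c : ℕ → 𝕜) (p : 𝕜) : 𝕜 :=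
  ∑ r ∈ Finset.range (n + 1), c r * ((n - r : ℕ) * p ^ (n - r - 1))

theorem hasDerivAt_revPoly (n : ℕ) (c : ℕ → 𝕜) (p : 𝕜) :
    HasDerivAt (revPoly n c) (revPolyDeriv n c p) p :=
  HasDerivAt.fun_sum fun r _ => (hasDerivAt_pow (n - r) p).const_mul (c r)

theorem mul_revPolyDeriv (n : ℕ) (c : ℕ → 𝕜) (p : 𝕜) :
    p * revPolyDeriv n c p = n * revPoly n c p - revPoly n (fun r => r * c r) p := by
  unfold revPolyDeriv revPoly
  rw [Finset.mul_sum, Finset.mul_sum, ← Finset.sum_sub_distrib]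
  refine Finset.sum_congr rfl fun r hr => ?_
  have hrn : r ≤ n := Nat.lt_succ_iff.1 (Finset.mem_range.1 hr)
  rw [Nat.cast_sub hrn]
  rcases Nat.eq_zero_or_pos (n - r) with h0 | h0
  · have : r = n := by omega
    subst this
    simp
  · obtain ⟨m, hm⟩ := Nat.exists_eq_succ_of_ne_zero h0.ne'
    rw [hm, Nat.succ_sub_one, pow_succ]
    ring

theorem revPoly_succ (n : ℕ) (c : ℕ → 𝕜) (p : 𝕜) :
    revPoly (n + 1) c p = p * revPoly n c p + c (n + 1) := by
  unfold revPoly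
  rw [Finset.sum_range_succ _ (n + 1), Finset.mul_sum, Nat.sub_self, pow_zero, mul_one]
  congr 1
  refine Finset.sum_congr rfl fun r hr => ?_
  have hrn : r ≤ n := Nat.lt_succ_iff.1 (Finset.mem_range.1 hr)
  rw [Nat.sub_add_comm hrn, pow_succ]
  ring

theorem revPoly_sum_mul (n : ℕ) (a : Fin N → 𝕜) (c : Fin N → ℕ → 𝕜) (p : 𝕜) :
    revPoly n (fun r => ∑ i, a i * c i r) p = ∑ i, a i * revPoly n (c i) p := by
  unfold revPoly
  simp only [Finset.mul_sum, Finset.sum_mul]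
  rw [Finset.sum_comm]
  simp only [mul_assoc]

/-- The hypotheses say `(1 + vX) e = a X s` as series. After truncation at order `n` only the
boundary terms at index `n` survive, and they do not depend on `p`. -/
theorem add_mul_revPoly {a v : 𝕜} {s e : ℕ → 𝕜} (h0 : e 0 = 0)
    (h : ∀ r, e (r + 1) + v * e r = a * s r) (n : ℕ) (p : 𝕜) :
    (p + v) * revPoly n e p = a * revPoly n s p - a * s n + v * e n := by
  induction n with
  | zero => simp [revPoly, h0]
  | succ n ih =>
    rw [revPoly_succ, revPoly_succ]
    linear_combination p * ih + p * h n

theorem powPlus_eq_revPoly (M n : ℕ) (u : Fin N → 𝕜) (p : 𝕜) :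
    powPlus M n u p = revPoly n (fun r => powCoeff M n r u) p := rfl

/-- The value of `(L^{n/(N-M)})_+` at the zero `p = -u^i` of `L`. -/
def powPlusAtRoot (M n : ℕ) (i : Fin N) (u : Fin N → 𝕜) : 𝕜 := powPlus M n u (-u i)

/-- At `p = -u^i` the left side of `add_mul_revPoly` vanishes, which identifies its constant
boundary term. -/
theorem laxExponent_mul_powPlusAtRoot (M n : ℕ) (i : Fin N) (u : Fin N → 𝕜) :
    laxExponent 𝕜 N M n * powPlusAtRoot M n i u =
      laxExponent 𝕜 N M n * powCoeff M n n u - u i * pd i (powCoeff M n n) u := by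
  obtain ⟨h0, h⟩ := pd_powCoeff M n i u
  have := add_mul_revPoly (e := fun r => pd i (powCoeff M n r) u)
    (s := fun r => powCoeff M n r u) h0 h n (-u i)
  rw [powPlusAtRoot, powPlus_eq_revPoly]
  linear_combination -this

theorem add_mul_revPoly_pd (M n : ℕ) (i : Fin N) (u : Fin N → 𝕜) (p : 𝕜) :
    (p + u i) * revPoly n (fun r => pd i (powCoeff M n r) u) p =
      laxExponent 𝕜 N M n * (powPlus M n u p - powPlusAtRoot M n i u) := by
  obtain ⟨h0, h⟩ := pd_powCoeff M n i u
  have := add_mul_revPoly (e := fun r => pd i (powCoeff M n r) u)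
    (s := fun r => powCoeff M n r u) h0 h n p
  rw [this, mul_sub, laxExponent_mul_powPlusAtRoot, powPlus_eq_revPoly]
  ring

theorem laxExponent_ne_zero {M n : ℕ} (h : M < N) (hn : 1 ≤ n) : laxExponent 𝕜 N M n ≠ 0 :=
  div_ne_zero (Nat.cast_ne_zero.2 (by omega)) (natCast_sub_ne_zero h)

theorem differentiable_powPlusAtRoot (M n : ℕ) (i : Fin N) :
    Differentiable 𝕜 (powPlusAtRoot (𝕜 := 𝕜) M n i) := by
  unfold powPlusAtRoot
  simp only [powPlus_eq_revPoly, revPoly]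
  refine Differentiable.fun_sum fun r _ => (differentiable_powCoeff M n r).mul ?_
  exact (differentiable_apply i).neg.pow _

theorem hasFDerivAt_revPoly {c : ℕ → (Fin N → 𝕜) → 𝕜} (hc : ∀ r, Differentiable 𝕜 (c r))
    (n : ℕ) (p : 𝕜) (u : Fin N → 𝕜) :
    ∃ T : (Fin N → 𝕜) →L[𝕜] 𝕜, HasFDerivAt (fun v => revPoly n (fun r => c r v) p) T u ∧
      ∀ h, T h = revPoly n (fun r => fderiv 𝕜 (c r) u h) p := by
  refine ⟨∑ r ∈ Finset.range (n + 1), p ^ (n - r) • fderiv 𝕜 (c r) u, ?_, fun h => ?_⟩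
  · exact HasFDerivAt.fun_sum fun r _ => (hc r u).hasFDerivAt.mul_const _
  · simp [revPoly, mul_comm]

theorem fderiv_add_mul_revPoly_pd (M n : ℕ) (i : Fin N) (u h : Fin N → 𝕜) (p : 𝕜) :
    h i * revPoly n (fun r => pd i (powCoeff M n r) u) p +
      (p + u i) * revPoly n (fun r => fderiv 𝕜 (pd i (powCoeff M n r)) u h) p =
    laxExponent 𝕜 N M n * (revPoly n (fun r => fderiv 𝕜 (powCoeff M n r) u h) p -
      fderiv 𝕜 (powPlusAtRoot M n i) u h) := by
  obtain ⟨T, hT, hT'⟩ := hasFDerivAt_revPoly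
    (c := fun r => pd i (powCoeff (𝕜 := 𝕜) (N := N) M n r))
    (fun r => (contDiff_pd (contDiff_powCoeff M n r) i).differentiable (by simp)) n p u
  obtain ⟨S, hS, hS'⟩ := hasFDerivAt_revPoly
    (c := fun r => powCoeff (𝕜 := 𝕜) (N := N) M n r) (differentiable_powCoeff M n) n p u
  have hB := (differentiable_powPlusAtRoot (𝕜 := 𝕜) M n i u).hasFDerivAt
  have hl : HasFDerivAt (fun v : Fin N → 𝕜 => p + v i)
      (ContinuousLinearMap.proj (R := 𝕜) (φ := fun _ : Fin N => 𝕜) i) u :=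
    (hasFDerivAt_apply (𝕜 := 𝕜) i u).const_add p
  have h1 := hl.mul hT
  have h2 := (hS.sub hB).const_mul (laxExponent 𝕜 N M n)
  have he : (fun v : Fin N → 𝕜 => (p + v i) * revPoly n (fun r => pd i (powCoeff M n r) v) p) =
      fun v => laxExponent 𝕜 N M n *
        (revPoly n (fun r => powCoeff M n r v) p - powPlusAtRoot M n i v) :=
    funext fun v => add_mul_revPoly_pd M n i v p
  have h3 : HasFDerivAt (fun v : Fin N → 𝕜 =>
      (p + v i) * revPoly n (fun r => pd i (powCoeff M n r) v) p) _ u := h1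
  rw [he] at h3
  have h4 := congrArg (fun L : (Fin N → 𝕜) →L[𝕜] 𝕜 => L h) (h3.unique h2)
  have h5 : (p + u i) * T h + revPoly n (fun r => pd i (powCoeff M n r) u) p * h i =
      laxExponent 𝕜 N M n * (S h - fderiv 𝕜 (powPlusAtRoot M n i) u h) := h4
  rw [hT', hS'] at h5
  linear_combination h5

theorem deriv_add_mul_revPoly_pd (M n : ℕ) (i : Fin N) (u : Fin N → 𝕜) (p : 𝕜) :
    revPoly n (fun r => pd i (powCoeff M n r) u) p +
      (p + u i) * revPolyDeriv n (fun r => pd i (powCoeff M n r) u) p =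
    laxExponent 𝕜 N M n * revPolyDeriv n (fun r => powCoeff M n r u) p := by
  have h1 := ((hasDerivAt_id p).add_const (u i)).mul
    (hasDerivAt_revPoly n (fun r => pd i (powCoeff M n r) u) p)
  have h2 := ((hasDerivAt_revPoly n (fun r => powCoeff M n r u) p).sub_const
    (powPlusAtRoot M n i u)).const_mul (laxExponent 𝕜 N M n)
  have h3 : HasDerivAt (fun q => (q + u i) * revPoly n (fun r => pd i (powCoeff M n r) u) q) _ p :=
    h1
  rw [funext fun q => add_mul_revPoly_pd M n i u q] at h3
  have h4 := h3.unique h2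
  simp only [id] at h4
  linear_combination h4

theorem fderiv_sum_mul_pd_powCoeff (M n r : ℕ) (u h : Fin N → 𝕜) :
    ∑ i, u i * fderiv 𝕜 (pd i (powCoeff M n r)) u h =
      r * fderiv 𝕜 (powCoeff M n r) u h - fderiv 𝕜 (powCoeff M n r) u h := by
  have h1 : HasFDerivAt (fun v : Fin N → 𝕜 => ∑ i, v i * pd i (powCoeff M n r) v) _ u :=
    HasFDerivAt.fun_sum fun i _ => HasFDerivAt.mul
      (show HasFDerivAt (fun v : Fin N → 𝕜 => v i)
        (ContinuousLinearMap.proj (R := 𝕜) (φ := fun _ : Fin N => 𝕜) i) u from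
        hasFDerivAt_apply (𝕜 := 𝕜) i u)
      ((contDiff_pd (contDiff_powCoeff M n r) i).differentiable (by simp) u).hasFDerivAt
  rw [funext fun v => sum_mul_pd_powCoeff M n r v] at h1
  have h2 := (differentiable_powCoeff (𝕜 := 𝕜) (N := N) M n r u).hasFDerivAt.const_mul (r : 𝕜)
  have h3 := congrArg (fun L : (Fin N → 𝕜) →L[𝕜] 𝕜 => L h) (h1.unique h2)
  simp only [sum_apply, add_apply,
    smul_apply, smul_eq_mul, ContinuousLinearMap.proj_apply,
    Finset.sum_add_distrib] at h3
  rw [← h3, fderiv_apply_eq_sum_pd (powCoeff M n r)]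
  simp only [mul_comm (h _)]
  ring

/-- The right-hand side of the Lax equation divided by `L`. -/
theorem sum_powPlusAtRoot_identity {M n : ℕ} (hMN : M < N) (hn : 1 ≤ n) (u h : Fin N → 𝕜) (p : 𝕜) :
    ∑ i, u i * fderiv 𝕜 (powPlusAtRoot M n i) u h * ∏ j ∈ Finset.univ.erase i, (p + u j) =
      p * revPolyDeriv n (fun r => powCoeff M n r u) p *
          ∑ i, h i * ∏ j ∈ Finset.univ.erase i, (p + u j) -
        revPoly n (fun r => fderiv 𝕜 (powCoeff M n r) u h) p *
          (p * ∑ i, ∏ j ∈ Finset.univ.erase i, (p + u j) - M * ∏ i, (p + u i)) := by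
  have hα := laxExponent_ne_zero (𝕜 := 𝕜) hMN hn
  have hd := natCast_sub_ne_zero (𝕜 := 𝕜) hMN
  set α := laxExponent 𝕜 N M n with hαd
  set E := ∏ i, (p + u i) with hE
  set Ei : Fin N → 𝕜 := fun i => ∏ j ∈ Finset.univ.erase i, (p + u j) with hEi
  have hmul : ∀ i, (p + u i) * Ei i = E := fun i =>
    Finset.mul_prod_erase Finset.univ (fun i => p + u i) (Finset.mem_univ i)
  set q : Fin N → 𝕜 := fun i => revPoly n (fun r => pd i (powCoeff M n r) u) p
  set q1 : Fin N → 𝕜 := fun i => revPolyDeriv n (fun r => pd i (powCoeff M n r) u) p with hq1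
  set qh : Fin N → 𝕜 := fun i => revPoly n (fun r => fderiv 𝕜 (pd i (powCoeff M n r)) u h) p
    with hqh
  set Gh := revPoly n (fun r => fderiv 𝕜 (powCoeff M n r) u h) p with hGh
  set C : Fin N → 𝕜 := fun i => fderiv 𝕜 (powPlusAtRoot M n i) u h
  set G1 := revPolyDeriv n (fun r => powCoeff M n r u) p
  have ha : ∀ i, h i * q i + (p + u i) * qh i = α * (Gh - C i) :=
    fun i => fderiv_add_mul_revPoly_pd M n i u h p
  have hb : ∀ i, q i + (p + u i) * q1 i = α * G1 := fun i => deriv_add_mul_revPoly_pd M n i u p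
  have hq : ∑ i, h i * q i = Gh := by
    rw [hGh, funext fun r => fderiv_apply_eq_sum_pd (powCoeff M n r) u h, revPoly_sum_mul]
  -- Euler's identity for the derivative of `B` along `h`, which is homogeneous of degree `n - 1` in
  -- `(u, p)` jointly: the coefficient of `p^{n-r}` has degree `r - 1` in `u`.
  have hEuler : ∑ i, u i * qh i + p * ∑ i, h i * q1 i = n * Gh - Gh := by
    have e1 : ∑ i, u i * qh i =
        revPoly n (fun r => r * fderiv 𝕜 (powCoeff M n r) u h) p - Gh := by
      rw [hqh, ← revPoly_sum_mul, funext fun r => fderiv_sum_mul_pd_powCoeff M n r u h, hGh]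
      simp only [revPoly, sub_mul, Finset.sum_sub_distrib]
    have e2 : p * ∑ i, h i * q1 i =
        n * Gh - revPoly n (fun r => r * fderiv 𝕜 (powCoeff M n r) u h) p := by
      have : ∀ i, p * (h i * q1 i) = n * (h i * q i) -
          h i * revPoly n (fun r => r * pd i (powCoeff M n r) u) p := by
        intro i
        rw [mul_left_comm, hq1, mul_revPolyDeriv]
        ring
      rw [Finset.mul_sum, Finset.sum_congr rfl fun i _ => this i, Finset.sum_sub_distrib,
        ← Finset.mul_sum, hq, ← revPoly_sum_mul]
      simp only [fderiv_apply_eq_sum_pd _ u h, Finset.mul_sum, mul_left_comm (h _)]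
    rw [e1, e2]
    ring
  have hαn : α * ((N : 𝕜) - M) = n := by
    rw [hαd, laxExponent]
    field_simp
  -- `ha` eliminates `C i`. Writing `u i = (p + u i) - p` and `(p + u i) * Ei i = E` leaves a term
  -- in `p * h i * q i * Ei i`, which `hb` trades for `G1` and `q1 i`.
  have hterm : ∀ i, α * (u i * C i * Ei i) = α * (p * G1 * (h i * Ei i)) - α * Gh * (p * Ei i) +
      α * E * Gh - E * (u i * qh i) - E * (p * (h i * q1 i)) - E * (h i * q i) := by
    intro i
    linear_combination (u i * Ei i) * ha i + p * h i * Ei i * hb i +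
      (α * Gh - u i * qh i - p * h i * q1 i - h i * q i) * hmul i
  refine mul_left_cancel₀ hα ?_
  rw [Finset.mul_sum, Finset.sum_congr rfl fun i _ => hterm i]
  simp only [Finset.sum_add_distrib, Finset.sum_sub_distrib, ← Finset.mul_sum, Finset.sum_const,
    Finset.card_univ, Fintype.card_fin, nsmul_eq_mul]
  rw [hq]
  -- The multiples of `E * Gh` add up to `α N - (n - 1) - 1 = α N - n = α M`, which is the
  -- contribution of the factor `p^{-M}` of `L`.
  linear_combination (-E) * hEuler + E * Gh * hαn

/-! ### The Lax equation as a Hamiltonian system -/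

/-- Chain rule mixing the scalars: `x` and `τ` are real, while functions of `u` are differentiated
over `𝕜`. -/
theorem hasDerivAt_comp_of_differentiableAt {E : Type*} [NormedAddCommGroup E] [NormedSpace 𝕜 E]
    [NormedSpace ℝ E] [IsScalarTower ℝ 𝕜 E] {f : E → 𝕜} {c : ℝ → E} {h : E} {x : ℝ}
    (hf : DifferentiableAt 𝕜 f (c x)) (hc : HasDerivAt c h x) :
    HasDerivAt (fun y => f (c y)) (fderiv 𝕜 f (c x) h) x :=
  (hf.hasFDerivAt.restrictScalars ℝ).comp_hasDerivAt x hc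

theorem fderiv_lax (M : ℕ) (u h : Fin N → 𝕜) (p : 𝕜) :
    DifferentiableAt 𝕜 (fun v => lax M v p) u ∧ fderiv 𝕜 (fun v => lax M v p) u h =
      (p ^ M)⁻¹ * ∑ i, h i * ∏ j ∈ Finset.univ.erase i, (p + u j) := by
  have h1 : HasFDerivAt (fun v : Fin N → 𝕜 => ∏ i, (p + v i)) _ u :=
    HasFDerivAt.finsetProd (u := Finset.univ) fun i _ =>
      (show HasFDerivAt (fun v : Fin N → 𝕜 => p + v i)
        (ContinuousLinearMap.proj (R := 𝕜) (φ := fun _ : Fin N => 𝕜) i) u from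
        (hasFDerivAt_apply (𝕜 := 𝕜) i u).const_add p)
  have h2 : HasFDerivAt (fun v => lax M v p) _ u := h1.const_mul ((p ^ M)⁻¹)
  refine ⟨h2.differentiableAt, ?_⟩
  rw [h2.fderiv]
  simp [mul_comm]

theorem deriv_lax {M : ℕ} (u : Fin N → 𝕜) {p : 𝕜} (hp : p ≠ 0) :
    p * deriv (fun q => lax M u q) p =
      (p ^ M)⁻¹ * (p * ∑ i, ∏ j ∈ Finset.univ.erase i, (p + u j) - M * ∏ i, (p + u i)) := by
  have h1 : HasDerivAt (fun q : 𝕜 => ∏ i, (q + u i)) _ p :=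
    HasDerivAt.fun_finsetProd (u := Finset.univ) fun i _ => (hasDerivAt_id p).add_const (u i)
  have h0 := (hasDerivAt_pow M p).inv (pow_ne_zero M hp)
  have h2 : HasDerivAt (fun q => lax M u q) _ p := h0.mul h1
  rw [h2.deriv]
  have h3 : p * ((M : 𝕜) * p ^ (M - 1)) = M * p ^ M := by
    cases M with
    | zero => simp
    | succ m => rw [Nat.succ_sub_one, pow_succ]; ring
  have hpM := pow_ne_zero M hp
  simp only [smul_eq_mul, mul_one, Pi.inv_apply]
  field_simp
  linear_combination (-∏ i, (p + u i)) * h3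

/-- Both sides of the Lax equation carry the factor `p^{-M}`; once it is removed,
`sum_powPlusAtRoot_identity` rewrites the right side in the polynomials `∏_{j ≠ i} (p + u^j)`, in
which `∂_τ L` is already expanded. -/
theorem laxEqAt_iff {M n : ℕ} (hMN : M < N) (hn : 1 ≤ n) {u : ℝ → ℝ → Fin N → 𝕜} {τ x : ℝ}
    (hτ : DifferentiableAt ℝ (fun σ => u σ x) τ) (hx : DifferentiableAt ℝ (fun y => u τ y) x) :
    LaxEqAt M n u τ x ↔ ∀ p : 𝕜, p ≠ 0 →
      ∑ i, (deriv (fun σ => u σ x i) τ - u τ x i *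
        fderiv 𝕜 (powPlusAtRoot M n i) (u τ x) (deriv (fun y => u τ y) x)) *
        ∏ j ∈ Finset.univ.erase i, (p + u τ x j) = 0 := by
  refine forall₂_congr fun p hp => ?_
  set h := deriv (fun y => u τ y) x with hh
  have hv : ∀ i, deriv (fun σ => u σ x) τ i = deriv (fun σ => u σ x i) τ :=
    fun i => ((hasDerivAt_pi.1 hτ.hasDerivAt) i).deriv.symm
  have e1 : deriv (fun σ => lax M (u σ x) p) τ = (p ^ M)⁻¹ *
      ∑ i, deriv (fun σ => u σ x i) τ * ∏ j ∈ Finset.univ.erase i, (p + u τ x j) := by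
    rw [(hasDerivAt_comp_of_differentiableAt (f := fun v => lax M v p)
      (c := fun σ => u σ x) (fderiv_lax M (u τ x) 0 p).1 hτ.hasDerivAt).deriv,
      (fderiv_lax M (u τ x) _ p).2]
    simp only [hv]
  have e2 : deriv (fun y => lax M (u τ y) p) x = (p ^ M)⁻¹ *
      ∑ i, h i * ∏ j ∈ Finset.univ.erase i, (p + u τ x j) := by
    rw [(hasDerivAt_comp_of_differentiableAt (f := fun v => lax M v p)
      (fderiv_lax M (u τ x) 0 p).1 hx.hasDerivAt).deriv, (fderiv_lax M (u τ x) _ p).2]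
  have e3 : deriv (fun y => powPlus M n (u τ y) p) x =
      revPoly n (fun r => fderiv 𝕜 (powCoeff M n r) (u τ x) h) p := by
    obtain ⟨T, hT, hT'⟩ := hasFDerivAt_revPoly
      (c := fun r => powCoeff (𝕜 := 𝕜) (N := N) M n r) (differentiable_powCoeff M n) n p (u τ x)
    have := (hasDerivAt_comp_of_differentiableAt hT.differentiableAt hx.hasDerivAt).deriv
    rw [hT.fderiv, hT'] at this
    exact this
  have e4 : deriv (fun q => powPlus M n (u τ x) q) p =
      revPolyDeriv n (fun r => powCoeff M n r (u τ x)) p :=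
    (hasDerivAt_revPoly n (fun r => powCoeff M n r (u τ x)) p).deriv
  have e5 := deriv_lax (M := M) (u τ x) hp
  have key := sum_powPlusAtRoot_identity hMN hn (u τ x) h p
  have hpM := inv_ne_zero (pow_ne_zero M hp)
  unfold pbPX
  rw [e1, e2, e3, e4, ← sub_eq_zero]
  simp only [sub_mul, Finset.sum_sub_distrib]
  rw [key]
  constructor
  · intro H
    refine (mul_eq_zero.1 (?_ : (p ^ M)⁻¹ * _ = 0)).resolve_left hpM
    linear_combination H - revPoly n (fun r => fderiv 𝕜 (powCoeff M n r) (u τ x) h) p * e5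
  · intro H
    linear_combination (p ^ M)⁻¹ * H +
      revPoly n (fun r => fderiv 𝕜 (powCoeff M n r) (u τ x) h) p * e5

/-- By Euler's identity the all-ones part of `η` contributes `Q`, and the diagonal part contributes
`-α⁻¹ u^i ∂_i Q`; their sum is `B(-u^i)` by `laxExponent_mul_powPlusAtRoot`. -/
theorem sum_logMetric_mul_pd_chargeDensity {M n : ℕ} (hMN : M < N) (hn : 1 ≤ n)
    (u : Fin N → 𝕜) (i : Fin N) :
    ∑ j, logMetric 𝕜 N M i j * (u j * ((n : 𝕜)⁻¹ * pd j (chargeDensity M n) u)) =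
      powPlusAtRoot M n i u := by
  have hα := laxExponent_ne_zero (𝕜 := 𝕜) hMN hn
  have hd := natCast_sub_ne_zero (𝕜 := 𝕜) hMN
  have hn' : (n : 𝕜) ≠ 0 := Nat.cast_ne_zero.2 (by omega)
  have hE := sum_mul_pd_powCoeff M n n u
  have hB := laxExponent_mul_powPlusAtRoot M n i u
  have hQ : chargeDensity M n = powCoeff (𝕜 := 𝕜) (N := N) M n n := rfl
  rw [sum_logMetric_mul, hQ]
  simp only [mul_left_comm (u _)]
  rw [← Finset.mul_sum, hE]
  refine mul_left_cancel₀ hα ?_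
  rw [hB, laxExponent]
  field_simp

theorem hamEqAt_iff {M n : ℕ} (hM : 0 < M) (hMN : M < N) (hn : 1 ≤ n) {u : ℝ → ℝ → Fin N → 𝕜}
    {τ x : ℝ} (hu : u τ x ∈ nonzeroDomain 𝕜 N)
    (hx : DifferentiableAt ℝ (fun y => u τ y) x) :
    HamEqAt (laxMetric M) (chargeGrad M n) u τ x ↔ ∀ i, deriv (fun σ => u σ x i) τ =
      u τ x i * fderiv 𝕜 (powPlusAtRoot M n i) (u τ x) (deriv (fun y => u τ y) x) := by
  have hQ : ContDiff 𝕜 ∞ (chargeDensity (𝕜 := 𝕜) (N := N) M n) := contDiff_powCoeff M n n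
  have huj : ∀ j, DifferentiableAt ℝ (fun y => u τ y j) x := differentiableAt_pi.1 hx
  have hξ : ∀ j, DifferentiableAt ℝ (fun y => chargeGrad M n (u τ) y j) x := fun j => by
    have h1 : DifferentiableAt 𝕜 (pd j (chargeDensity (𝕜 := 𝕜) (N := N) M n)) (u τ x) :=
      (contDiff_pd hQ j).differentiable (by simp) _
    exact (hasDerivAt_comp_of_differentiableAt h1
      hx.hasDerivAt).differentiableAt.const_mul _
  refine forall_congr' fun i => ?_
  rw [hydroOp_laxMetric hM hMN hu huj hξ]
  have h1 : HasDerivAt (fun y => ∑ j, logMetric 𝕜 N M i j * (u τ y j * chargeGrad M n (u τ) y j))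
      (∑ j, logMetric 𝕜 N M i j * deriv (fun y => u τ y j * chargeGrad M n (u τ) y j) x) x :=
    HasDerivAt.fun_sum fun j _ => ((huj j).mul (hξ j)).hasDerivAt.const_mul _
  have h2 : (fun y => ∑ j, logMetric 𝕜 N M i j * (u τ y j * chargeGrad M n (u τ) y j)) =
      fun y => powPlusAtRoot M n i (u τ y) :=
    funext fun y => sum_logMetric_mul_pd_chargeDensity hMN hn (u τ y) i
  rw [h2] at h1
  rw [h1.unique (hasDerivAt_comp_of_differentiableAt
    (differentiable_powPlusAtRoot M n i (u τ x)) hx.hasDerivAt)]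

theorem laxEqAt_of_hamEqAt {M n : ℕ} (hM : 0 < M) (hMN : M < N) (hn : 1 ≤ n)
    {u : ℝ → ℝ → Fin N → 𝕜} {τ x : ℝ} (hu : u τ x ∈ nonzeroDomain 𝕜 N)
    (hτ : DifferentiableAt ℝ (fun σ => u σ x) τ) (hx : DifferentiableAt ℝ (fun y => u τ y) x)
    (H : HamEqAt (laxMetric M) (chargeGrad M n) u τ x) : LaxEqAt M n u τ x := by
  rw [hamEqAt_iff hM hMN hn hu hx] at H
  rw [laxEqAt_iff hMN hn hτ hx]
  intro p _
  exact Finset.sum_eq_zero fun i _ => by rw [H i, sub_self, zero_mul]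

theorem hamEqAt_of_laxEqAt {M n : ℕ} (hM : 0 < M) (hMN : M < N) (hn : 1 ≤ n)
    {u : ℝ → ℝ → Fin N → 𝕜} {τ x : ℝ} (hu : u τ x ∈ nonzeroDomain 𝕜 N)
    (hτ : DifferentiableAt ℝ (fun σ => u σ x) τ) (hx : DifferentiableAt ℝ (fun y => u τ y) x)
    (hinj : Function.Injective (u τ x)) (H : LaxEqAt M n u τ x) :
    HamEqAt (laxMetric M) (chargeGrad M n) u τ x := by
  rw [laxEqAt_iff hMN hn hτ hx] at H
  rw [hamEqAt_iff hM hMN hn hu hx]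
  intro i
  -- Lagrange interpolation: at `p = -u^i`, an admissible value since `u^i ≠ 0`, only the `i`-th
  -- product survives, and distinctness makes it non-zero.
  have h1 := H (-u τ x i) (neg_ne_zero.2 (hu i))
  rw [Finset.sum_eq_single i] at h1
  · refine sub_eq_zero.1 ((mul_eq_zero.1 h1).resolve_right ?_)
    refine Finset.prod_ne_zero_iff.2 fun j hj => ?_
    rw [neg_add_eq_sub, sub_ne_zero]
    exact fun e => Finset.ne_of_mem_erase hj (hinj e)
  · intro k _ hk
    rw [Finset.prod_eq_zero (Finset.mem_erase.2 ⟨hk.symm, Finset.mem_univ i⟩) (by simp), mul_zero]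
  · exact fun hi => absurd (Finset.mem_univ i) hi

/-! ### Integrals depending smoothly on parameters -/

section Parametric

variable {E : Type*} [NormedAddCommGroup E] [NormedSpace ℝ E]

theorem hasDerivAt_comp_curve {G : E → 𝕜} (hG : ContDiff ℝ ∞ G) {γ : ℝ → E} {v : E}
    {t : ℝ} (hγ : HasDerivAt γ v t) : HasDerivAt (fun r => G (γ r)) (fderiv ℝ G (γ t) v) t :=
  ((hG.differentiable (by simp)) (γ t)).hasFDerivAt.comp_hasDerivAt t hγ

theorem hasFDerivAt_integral_of_contDiff [ProperSpace E] {G : E × ℝ → 𝕜} (hG : ContDiff ℝ ∞ G)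
    (q : E) : ∃ T : E →L[ℝ] 𝕜, HasFDerivAt (fun q => ∫ x in (0 : ℝ)..1, G (q, x)) T q ∧
      ∀ v, T v = ∫ x in (0 : ℝ)..1, fderiv ℝ G (q, x) (v, 0) := by
  set F' : E → ℝ → E →L[ℝ] 𝕜 := fun q x =>
    (fderiv ℝ G (q, x)).comp (ContinuousLinearMap.inl ℝ E ℝ) with hF'
  have hc : Continuous fun z : E × ℝ => F' z.1 z.2 :=
    ((hG.continuous_fderiv (by simp)).clm_comp continuous_const)
  have hcq : ∀ q, Continuous (F' q) := fun q =>
    hc.comp (by fun_prop : Continuous fun x : ℝ => (q, x))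
  -- Compactness of the ball times `[0, 1]` provides the constant dominating the derivative of the
  -- integrand.
  obtain ⟨C, hC⟩ := ((isCompact_closedBall q 1).prod 
    (isCompact_Icc (a := (0 : ℝ)) (b := 1))).exists_bound_of_continuousOn hc.continuousOn
  refine ⟨∫ x in (0 : ℝ)..1, F' q x, ?_, fun v => ?_⟩
  · refine intervalIntegral.hasFDerivAt_integral_of_dominated_of_fderiv_le
      (F := fun q x => G (q, x)) (F' := F')
      (bound := fun _ => C) (Metric.closedBall_mem_nhds q one_pos) ?_ ?_ ?_ ?_ ?_ ?_
    · exact Filter.Eventually.of_forall fun p =>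
        (hG.continuous.comp (by fun_prop : Continuous fun x : ℝ => (p, x))).aestronglyMeasurable
    · exact (hG.continuous.comp
        (by fun_prop : Continuous fun x : ℝ => (q, x))).intervalIntegrable _ _
    · exact (hcq q).aestronglyMeasurable
    · refine Filter.Eventually.of_forall fun x hx p hp => hC (p, x) ⟨hp, ?_⟩
      rw [Set.uIoc_of_le zero_le_one] at hx
      exact ⟨hx.1.le, hx.2⟩
    · exact intervalIntegrable_const
    · refine Filter.Eventually.of_forall fun x _ p _ => ?_
      exact ((hG.differentiable (by simp)) (p, x)).hasFDerivAt.comp p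
        (hasFDerivAt_prodMk_left p x)
  · rw [ContinuousLinearMap.intervalIntegral_apply ((hcq q).intervalIntegrable _ _)]
    rfl

theorem hasDerivAt_integral_of_contDiff {G : ℝ × ℝ → 𝕜} (hG : ContDiff ℝ ∞ G) (s : ℝ) :
    HasDerivAt (fun s => ∫ x in (0 : ℝ)..1, G (s, x))
      (∫ x in (0 : ℝ)..1, deriv (fun r => G (r, x)) s) s := by
  obtain ⟨T, hT, hTv⟩ := hasFDerivAt_integral_of_contDiff hG s
  have h := hT.hasDerivAt
  rw [hTv] at h
  convert h using 3 with x
  exact (hasDerivAt_comp_curve hG ((hasDerivAt_id s).prodMk (hasDerivAt_const s x))).deriv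

/-- Continuous partial derivatives make `f` differentiable with `df = α ds + β dt`. This is
differentiable again, so the second derivative is symmetric. No regularity of `f` is assumed
beforehand: a functional is known only through its first variation. -/
theorem fderiv_eq_of_hasDerivAt_partial {f : ℝ → ℝ → 𝕜} {α β : ℝ × ℝ → 𝕜}
    (hα : Differentiable ℝ α) (hβ : Differentiable ℝ β)
    (hs : ∀ s t, HasDerivAt (fun r => f r t) (α (s, t)) s)
    (ht : ∀ s t, HasDerivAt (fun r => f s r) (β (s, t)) t) (z : ℝ × ℝ) :
    fderiv ℝ β z (1, 0) = fderiv ℝ α z (0, 1) := by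
  set S := ContinuousLinearMap.smulRightL ℝ (ℝ × ℝ) 𝕜 (ContinuousLinearMap.fst ℝ ℝ ℝ) with hS
  set T := ContinuousLinearMap.smulRightL ℝ (ℝ × ℝ) 𝕜 (ContinuousLinearMap.snd ℝ ℝ ℝ) with hT
  have h1 : ∀ v : ℝ × ℝ, HasFDerivAt (fun v : ℝ × ℝ => f v.1 v.2) (S (α v) + T (β v)) v := by
    intro v
    have := (hasStrictFDerivAt_uncurry_coprod (𝕜 := ℝ) (u := v) (f := f)
      (f₁ := fun s t => ContinuousLinearMap.toSpanSingleton ℝ (α (s, t)))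
      (f₂ := fun s t => ContinuousLinearMap.toSpanSingleton ℝ (β (s, t)))
      (Filter.Eventually.of_forall fun w => hs w.1 w.2)
      (Filter.Eventually.of_forall fun w => ht w.1 w.2)
      ((ContinuousLinearMap.toSpanSingletonCLE.continuous.comp hα.continuous).continuousAt)
      ((ContinuousLinearMap.toSpanSingletonCLE.continuous.comp hβ.continuous).continuousAt)
      ).hasFDerivAt
    refine this.congr_fderiv ?_
    ext <;> simp [hS, hT, Function.HasUncurry.uncurry]
  have h2 : HasFDerivAt (fun v => S (α v) + T (β v))
      (S.comp (fderiv ℝ α z) + T.comp (fderiv ℝ β z)) z :=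
    (S.hasFDerivAt.comp z (hα z).hasFDerivAt).add (T.hasFDerivAt.comp z (hβ z).hasFDerivAt)
  have := second_derivative_symmetric h1 h2 (1, 0) (0, 1)
  simpa [hS, hT] using this

/-- Equality of mixed derivatives of a function whose partial derivatives are integrals of smooth
functions. -/
theorem integral_deriv_eq_of_hasDerivAt_partial {f : ℝ → ℝ → 𝕜} {A B : (ℝ × ℝ) × ℝ → 𝕜}
    (hA : ContDiff ℝ ∞ A) (hB : ContDiff ℝ ∞ B)
    (hs : ∀ s t, HasDerivAt (fun r => f r t) (∫ x in (0 : ℝ)..1, A ((s, t), x)) s)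
    (ht : ∀ s t, HasDerivAt (fun r => f s r) (∫ x in (0 : ℝ)..1, B ((s, t), x)) t) (s t : ℝ) :
    ∫ x in (0 : ℝ)..1, deriv (fun r => B ((r, t), x)) s =
      ∫ x in (0 : ℝ)..1, deriv (fun r => A ((s, r), x)) t := by
  choose TA hTA hTA' using hasFDerivAt_integral_of_contDiff hA
  choose TB hTB hTB' using hasFDerivAt_integral_of_contDiff hB
  have := fderiv_eq_of_hasDerivAt_partial (fun q => (hTA q).differentiableAt)
    (fun q => (hTB q).differentiableAt) hs ht (s, t)
  rw [(hTA _).fderiv, (hTB _).fderiv, hTA', hTB'] at this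
  convert this using 3 with x x
  · exact (hasDerivAt_comp_curve hB
      (((hasDerivAt_id s).prodMk (hasDerivAt_const s t)).prodMk (hasDerivAt_const s x))).deriv
  · exact (hasDerivAt_comp_curve hA
      (((hasDerivAt_const t s).prodMk (hasDerivAt_id t)).prodMk (hasDerivAt_const t x))).deriv

theorem contDiff_deriv_snd {G : E × ℝ → 𝕜} (hG : ContDiff ℝ ∞ G) :
    ContDiff ℝ ∞ fun z : E × ℝ => deriv (fun y => G (z.1, y)) z.2 := by
  have : (fun z : E × ℝ => deriv (fun y => G (z.1, y)) z.2) = fun z => fderiv ℝ G z (0, 1) :=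
    funext fun z => (hasDerivAt_comp_curve hG
      ((hasDerivAt_const z.2 z.1).prodMk (hasDerivAt_id z.2))).deriv
  rw [this]
  exact (hG.fderiv_right (m := ∞) (by simp)).clm_apply contDiff_const

theorem contDiff_deriv_fst {G : ℝ × E → 𝕜} (hG : ContDiff ℝ ∞ G) :
    ContDiff ℝ ∞ fun z : ℝ × E => deriv (fun y => G (y, z.2)) z.1 :=
  (contDiff_deriv_snd (G := fun z : E × ℝ => G (z.2, z.1))
    (hG.comp (contDiff_snd.prodMk contDiff_fst))).comp (contDiff_snd.prodMk contDiff_fst)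

theorem hasDerivAt_deriv_comm {G : ℝ × ℝ → 𝕜} (hG : ContDiff ℝ ∞ G) (s x : ℝ) :
    HasDerivAt (fun r => deriv (fun y => G (r, y)) x)
      (deriv (fun y => deriv (fun r => G (r, y)) s) x) s := by
  have h2 := (hasDerivAt_comp_curve (contDiff_deriv_snd hG)
    ((hasDerivAt_id s).prodMk (hasDerivAt_const s x)))
  have h1 := (hasDerivAt_comp_curve (contDiff_deriv_fst hG)
    ((hasDerivAt_const x s).prodMk (hasDerivAt_id x))).deriv
  simp only [id] at h1 h2
  rw [h1]
  convert h2 using 1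
  refine (fderiv_eq_of_hasDerivAt_partial (f := fun r y => G (r, y))
    ((contDiff_deriv_fst hG).differentiable (by simp))
    ((contDiff_deriv_snd hG).differentiable (by simp)) (fun r y => ?_) (fun r y => ?_) (s, x)).symm
  · exact (hasDerivAt_comp_curve hG
      ((hasDerivAt_id r).prodMk (hasDerivAt_const r y))).differentiableAt.hasDerivAt
  · exact (hasDerivAt_comp_curve hG
      ((hasDerivAt_const y r).prodMk (hasDerivAt_id y))).differentiableAt.hasDerivAt

end Parametric

/-! ### The exponential, uniformly over `ℝ` and `ℂ` -/

theorem contDiff_exp_real : ContDiff ℝ ∞ (NormedSpace.exp : 𝕜 → 𝕜) :=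
  contDiff_iff_contDiffAt.2 fun x => (NormedSpace.exp_analytic (𝕂 := ℝ) x).contDiffAt

theorem exp_ne_zero_rclike (x : 𝕜) : NormedSpace.exp x ≠ 0 :=
  (NormedSpace.isUnit_exp x).ne_zero

/-! ### Logarithmic variations of loops -/

theorem contDiff_exp_smul {E : Type*} [NormedAddCommGroup E] [NormedSpace ℝ E] {f : E → ℝ}
    {g : E → 𝕜} (hf : ContDiff ℝ ∞ f) (hg : ContDiff ℝ ∞ g) :
    ContDiff ℝ ∞ fun x => NormedSpace.exp (f x • g x) :=
  contDiff_exp_real.comp (hf.smul hg)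

/-- Smooth periodic fields with values in `𝕜 ^ N`. -/
def PeriodicField (𝕜 : Type*) [RCLike 𝕜] (N : ℕ) : Type _ :=
  {ψ : ℝ → Fin N → 𝕜 // ContDiff ℝ ∞ ψ ∧ Function.Periodic ψ 1}

/-- The curve of loops `t ↦ u exp(t ψ)`. -/
def Loop.flow (u : Loop (nonzeroDomain 𝕜 N)) (ψ : PeriodicField 𝕜 N) (t : ℝ) :
    Loop (nonzeroDomain 𝕜 N) :=
  ⟨fun x i => u.1 x i * NormedSpace.exp (t • ψ.1 x i),
    contDiff_pi.2 fun i => (contDiff_pi.1 u.2.1 i).mul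
      (contDiff_exp_smul contDiff_const (contDiff_pi.1 ψ.2.1 i)),
    fun x => by simp only [u.2.2.1 x, ψ.2.2 x],
    fun x i => mul_ne_zero (u.2.2.2 x i) (exp_ne_zero_rclike _)⟩

theorem Loop.flow_zero (u : Loop (nonzeroDomain 𝕜 N)) (ψ : PeriodicField 𝕜 N) :
    u.flow ψ 0 = u :=
  Subtype.ext (by funext x i; simp [Loop.flow])

/-- The pairing `∫ ∑_i a_i b_i dx`. -/
def pairing (a b : ℝ → Fin N → 𝕜) : 𝕜 := ∫ x in (0 : ℝ)..1, ∑ i, a x i * b x i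

theorem pairing_comm (a b : ℝ → Fin N → 𝕜) : pairing a b = pairing b a := by
  simp only [pairing, mul_comm]

/-- The logarithmic velocity `∂_s w / w` of a curve of loops. -/
def logVel (w : ℝ → Loop (nonzeroDomain 𝕜 N)) (s x : ℝ) (i : Fin N) : 𝕜 :=
  ((w s).1 x i)⁻¹ * deriv (fun r => (w r).1 x i) s

theorem hasDerivAt_flow (u : Loop (nonzeroDomain 𝕜 N)) (ψ : PeriodicField 𝕜 N) (t x : ℝ)
    (i : Fin N) : HasDerivAt (fun r => (u.flow ψ r).1 x i) ((u.flow ψ t).1 x i * ψ.1 x i) t := by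
  have h := (hasDerivAt_exp_smul_const (𝕂 := ℝ) (ψ.1 x i) t).const_mul (u.1 x i)
  rw [← mul_assoc] at h
  exact h

theorem logVel_flow (u : Loop (nonzeroDomain 𝕜 N)) (ψ : PeriodicField 𝕜 N) (t : ℝ) :
    logVel (u.flow ψ) t = ψ.1 := by
  funext x i
  rw [logVel, (hasDerivAt_flow u ψ t x i).deriv, inv_mul_cancel_left₀ ((u.flow ψ t).2.2.2 x i)]

/-- The flow multiplies by a factor independent of `s`, which drops out of the logarithmic
derivative. -/
theorem logVel_flow_left (w : ℝ → Loop (nonzeroDomain 𝕜 N)) (ψ : PeriodicField 𝕜 N) (s t : ℝ) :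
    logVel (fun r => (w r).flow ψ t) s = logVel w s := by
  funext x i
  have h1 := (w s).2.2.2 x i
  have h2 := exp_ne_zero_rclike (t • ψ.1 x i)
  simp only [logVel, Loop.flow, deriv_mul_const_field]
  field_simp

section Families

variable {E : Type*} [NormedAddCommGroup E] [NormedSpace ℝ E]

/-- A family of loops is smooth. -/
def SmoothFamily {U : Set (Fin N → 𝕜)} (w : E → Loop U) : Prop :=
  ContDiff ℝ ∞ fun q : E × ℝ => (w q.1).1 q.2

theorem SmoothFamily.flow {w : E → Loop (nonzeroDomain 𝕜 N)} (hw : SmoothFamily w)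
    {ψ : E → PeriodicField 𝕜 N} (hψ : ContDiff ℝ ∞ fun q : E × ℝ => (ψ q.1).1 q.2) :
    SmoothFamily fun q : E × ℝ => (w q.1).flow (ψ q.1) q.2 := by
  refine contDiff_pi.2 fun i => ?_
  have hπ : ContDiff ℝ ∞ fun q : (E × ℝ) × ℝ => (q.1.1, q.2) :=
    (contDiff_fst.comp contDiff_fst).prodMk contDiff_snd
  exact ((contDiff_pi.1 hw i).comp hπ).mul (contDiff_exp_smul
    (contDiff_snd.comp contDiff_fst) ((contDiff_pi.1 hψ i).comp hπ))

theorem smoothFamily_flow (u : Loop (nonzeroDomain 𝕜 N)) (ψ : PeriodicField 𝕜 N) :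
    SmoothFamily (u.flow ψ) :=
  contDiff_pi.2 fun i => ((contDiff_pi.1 u.2.1 i).comp contDiff_snd).mul
    (contDiff_exp_smul contDiff_fst ((contDiff_pi.1 ψ.2.1 i).comp contDiff_snd))

theorem SmoothFamily.contDiff_logVel {w : ℝ → Loop (nonzeroDomain 𝕜 N)} (hw : SmoothFamily w)
    (i : Fin N) : ContDiff ℝ ∞ fun q : ℝ × ℝ => logVel w q.1 q.2 i :=
  ((contDiff_pi.1 hw i).inv fun q => (w q.1).2.2.2 q.2 i).mul
    (contDiff_deriv_fst (contDiff_pi.1 hw i))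

/-- Linear coordinates on `E` reduce this to parameter spaces `Fin m → ℝ`; products such as `E × ℝ`
are then allowed as well. -/
theorem IsVarDeriv.contDiff_family [FiniteDimensional ℝ E] {U : Set (Fin N → 𝕜)} {F : Loop U → 𝕜}
    {δF : Loop U → ℝ → Fin N → 𝕜} (hF : IsVarDeriv F δF) {w : E → Loop U}
    (hw : SmoothFamily w) : ContDiff ℝ ∞ fun q : E × ℝ => δF (w q.1) q.2 := by
  let e : E ≃L[ℝ] (Fin (Module.finrank ℝ E) → ℝ) := ContinuousLinearEquiv.ofFinrankEq (by simp)
  have h1 := hF.smooth _ (fun q => w (e.symm q))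
    (ContDiff.comp hw ((e.symm.contDiff.comp contDiff_fst).prodMk contDiff_snd))
  have h2 := h1.comp ((e.contDiff.comp contDiff_fst).prodMk contDiff_snd : ContDiff ℝ ∞
    fun q : E × ℝ => (e q.1, q.2))
  simpa [Function.comp_def] using h2

/-- The variational derivative with respect to `log u`. -/
def logGrad (δF : Loop (nonzeroDomain 𝕜 N) → ℝ → Fin N → 𝕜) (u : Loop (nonzeroDomain 𝕜 N))
    (x : ℝ) (i : Fin N) : 𝕜 := u.1 x i * δF u x i

theorem IsVarDeriv.contDiff_logGrad [FiniteDimensional ℝ E] {F : Loop (nonzeroDomain 𝕜 N) → 𝕜}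
    {δF : Loop (nonzeroDomain 𝕜 N) → ℝ → Fin N → 𝕜} (hF : IsVarDeriv F δF)
    {w : E → Loop (nonzeroDomain 𝕜 N)} (hw : SmoothFamily w) (i : Fin N) :
    ContDiff ℝ ∞ fun q : E × ℝ => logGrad δF (w q.1) q.2 i :=
  (contDiff_pi.1 hw i).mul (contDiff_pi.1 (hF.contDiff_family hw) i)

end Families

/-! ### Logarithmic gradients and the first variation of the bracket -/

variable {F G H : Loop (nonzeroDomain 𝕜 N) → 𝕜}
  {δF δG δH : Loop (nonzeroDomain 𝕜 N) → ℝ → Fin N → 𝕜}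

/-- `logGrad` as a smooth periodic field. -/
def IsVarDeriv.gradField (hF : IsVarDeriv F δF) (u : Loop (nonzeroDomain 𝕜 N)) :
    PeriodicField 𝕜 N :=
  ⟨logGrad δF u, contDiff_pi.2 fun i =>
    -- Smoothness in `x` alone comes from the constant family of loops, restricted to one parameter
    -- value.
    (hF.contDiff_logGrad (E := ℝ) (w := fun _ => u) (u.2.1.comp contDiff_snd) i).comp
      (contDiff_prodMk_right (0 : ℝ)),
    fun x => by funext i; simp only [logGrad, u.2.2.1 x, hF.periodic u x]⟩

theorem deriv_periodic {f : ℝ → 𝕜} (hf : Function.Periodic f 1) :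
    Function.Periodic (deriv f) 1 := fun x => by
  rw [← deriv_comp_add_const, funext hf]

/-- The operator `η^{ij} d/dx` with constant coefficients. -/
def PeriodicField.op (M : ℕ) (b : PeriodicField 𝕜 N) : PeriodicField 𝕜 N :=
  ⟨fun x i => ∑ j, logMetric 𝕜 N M i j * deriv (fun y => b.1 y j) x,
    contDiff_pi.2 fun i => ContDiff.sum fun j _ => contDiff_const.mul
      ((contDiff_deriv_snd (E := ℝ) (G := fun z => b.1 z.2 j)
        ((contDiff_pi.1 b.2.1 j).comp contDiff_snd)).comp (contDiff_prodMk_right (0 : ℝ))),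
    fun x => by
      funext i
      refine Finset.sum_congr rfl fun j _ => ?_
      rw [deriv_periodic (f := fun y => b.1 y j) (fun y => by simp only [b.2.2 y]) x]⟩

theorem PeriodicField.differentiable (b : PeriodicField 𝕜 N) (i : Fin N) :
    Differentiable ℝ fun y => b.1 y i :=
  (contDiff_pi.1 b.2.1 i).differentiable (by simp)

theorem PeriodicField.continuous (b : PeriodicField 𝕜 N) (i : Fin N) :
    Continuous fun y => b.1 y i := (contDiff_pi.1 b.2.1 i).continuous

theorem intervalIntegrable_pairing (a b : PeriodicField 𝕜 N) :
    IntervalIntegrable (fun x => ∑ i, a.1 x i * b.1 x i) MeasureTheory.volume 0 1 :=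
  (continuous_finsetSum _ fun i _ => (a.continuous i).mul (b.continuous i)).intervalIntegrable _ _

/-- Integration by parts: as `η` is symmetric, the sum of the two integrands is the `x`-derivative
of the periodic function `∑ η^{ij} a_i b_j`. -/
theorem pairing_op (M : ℕ) (a b : PeriodicField 𝕜 N) :
    pairing a.1 (b.op M).1 = -pairing (a.op M).1 b.1 := by
  rw [eq_neg_iff_add_eq_zero, pairing, pairing, ← intervalIntegral.integral_add
    (intervalIntegrable_pairing a (b.op M)) (intervalIntegrable_pairing (a.op M) b)]
  have hd : ∀ x, HasDerivAt (fun x => ∑ i, ∑ j, logMetric 𝕜 N M i j * (a.1 x i * b.1 x j))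
      (∑ i, a.1 x i * (b.op M).1 x i + ∑ i, (a.op M).1 x i * b.1 x i) x := by
    intro x
    have h : HasDerivAt (fun x => ∑ i, ∑ j, logMetric 𝕜 N M i j * (a.1 x i * b.1 x j)) _ x :=
      HasDerivAt.fun_sum fun i _ => HasDerivAt.fun_sum fun j _ =>
        ((a.differentiable i x).hasDerivAt.mul (b.differentiable j x).hasDerivAt).const_mul _
    convert h using 1
    have e1 : ∑ i, (a.op M).1 x i * b.1 x i =
        ∑ i, ∑ j, logMetric 𝕜 N M i j * (deriv (fun y => a.1 y i) x * b.1 x j) := by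
      rw [Finset.sum_comm]
      refine Finset.sum_congr rfl fun i _ => ?_
      simp only [PeriodicField.op, Finset.sum_mul]
      refine Finset.sum_congr rfl fun j _ => ?_
      rw [logMetric_comm, mul_assoc]
    have e2 : ∑ i, a.1 x i * (b.op M).1 x i =
        ∑ i, ∑ j, logMetric 𝕜 N M i j * (a.1 x i * deriv (fun y => b.1 y j) x) := by
      refine Finset.sum_congr rfl fun i _ => ?_
      simp only [PeriodicField.op, Finset.mul_sum, mul_left_comm]
    rw [e1, e2]
    simp only [← Finset.sum_add_distrib]
    refine Finset.sum_congr rfl fun i _ => Finset.sum_congr rfl fun j _ => ?_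
    ring
  rw [intervalIntegral.integral_eq_sub_of_hasDerivAt (fun x _ => hd x)
    ((intervalIntegrable_pairing a (b.op M)).add (intervalIntegrable_pairing (a.op M) b))]
  have ha : a.1 1 = a.1 0 := by simpa using a.2.2 0
  have hb : b.1 1 = b.1 0 := by simpa using b.2.2 0
  rw [ha, hb, sub_self]

theorem bracket_eq_pairing {M : ℕ} (hM : 0 < M) (hMN : M < N)
    (δF : Loop (nonzeroDomain 𝕜 N) → ℝ → Fin N → 𝕜) (hG : IsVarDeriv G δG)
    (u : Loop (nonzeroDomain 𝕜 N)) :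
    bracket (laxMetric M) δF δG u = pairing (logGrad δF u) ((hG.gradField u).op M).1 := by
  unfold bracket pairing
  refine congrArg (fun f : ℝ → 𝕜 => ∫ x in (0 : ℝ)..1, f x) (funext fun x =>
    Finset.sum_congr rfl fun i _ => ?_)
  have hu : ∀ j, DifferentiableAt ℝ (fun y => u.1 y j) x :=
    fun j => (contDiff_pi.1 u.2.1 j).differentiable (by simp) x
  have hξ : ∀ j, DifferentiableAt ℝ (fun y => δG u y j) x := fun j =>
    (((contDiff_pi.1 (hG.contDiff_family (E := ℝ) (w := fun _ => u)
      (u.2.1.comp contDiff_snd)) j).comp (contDiff_prodMk_right (0 : ℝ))).differentiable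
        (by simp) x)
  rw [hydroOp_laxMetric hM hMN (u.2.2.2 x) hu hξ]
  simp only [PeriodicField.op, IsVarDeriv.gradField, logGrad]
  ring

theorem IsVarDeriv.hasDerivAt_pairing (hF : IsVarDeriv F δF) {w : ℝ → Loop (nonzeroDomain 𝕜 N)}
    (hw : SmoothFamily w) (s : ℝ) :
    HasDerivAt (fun r => F (w r)) (pairing (logGrad δF (w s)) (logVel w s)) s := by
  convert hF.variation w hw s using 1
  unfold pairing
  refine congrArg (fun f : ℝ → 𝕜 => ∫ x in (0 : ℝ)..1, f x) (funext fun x =>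
    Finset.sum_congr rfl fun i _ => ?_)
  have := (w s).2.2.2 x i
  simp only [logGrad, logVel]
  field_simp

/-- The derivative of `logGrad δF` at `u` in the direction `u ψ`. -/
def logHess (δF : Loop (nonzeroDomain 𝕜 N) → ℝ → Fin N → 𝕜) (ψ : PeriodicField 𝕜 N)
    (u : Loop (nonzeroDomain 𝕜 N)) (x : ℝ) (i : Fin N) : 𝕜 :=
  deriv (fun t => logGrad δF (u.flow ψ t) x i) 0

/-- The second variational derivative is symmetric. -/
theorem IsVarDeriv.pairing_deriv_logGrad (hF : IsVarDeriv F δF)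
    {w : ℝ → Loop (nonzeroDomain 𝕜 N)} (hw : SmoothFamily w) (ψ : PeriodicField 𝕜 N) (s : ℝ) :
    pairing (fun x i => deriv (fun r => logGrad δF (w r) x i) s) ψ.1 =
      pairing (logHess δF ψ (w s)) (logVel w s) := by
  have hψ : ContDiff ℝ ∞ fun q : ℝ × ℝ => ψ.1 q.2 := ψ.2.1.comp contDiff_snd
  have hW : SmoothFamily fun q : ℝ × ℝ => (w q.1).flow ψ q.2 := hw.flow (ψ := fun _ => ψ) hψ
  have ha := fun i => hF.contDiff_logGrad hW i
  have hA : ContDiff ℝ ∞ fun q : (ℝ × ℝ) × ℝ =>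
      ∑ i, logGrad δF ((w q.1.1).flow ψ q.1.2) q.2 i * logVel w q.1.1 q.2 i :=
    ContDiff.sum fun i _ => (ha i).mul ((hw.contDiff_logVel i).comp
      ((contDiff_fst.comp contDiff_fst).prodMk contDiff_snd))
  have hB : ContDiff ℝ ∞ fun q : (ℝ × ℝ) × ℝ =>
      ∑ i, logGrad δF ((w q.1.1).flow ψ q.1.2) q.2 i * ψ.1 q.2 i :=
    ContDiff.sum fun i _ => (ha i).mul ((contDiff_pi.1 ψ.2.1 i).comp contDiff_snd)
  -- Mixed derivatives of `F(w_s exp(tψ))` at `t = 0`: the logarithmic velocity is that of `w` in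
  -- the `s` direction and `ψ` in the `t` direction, so neither depends on the other parameter.
  have key := integral_deriv_eq_of_hasDerivAt_partial (f := fun s t => F ((w s).flow ψ t)) hA hB
    (fun s t => by
      have := hF.hasDerivAt_pairing (w := fun r => (w r).flow ψ t)
        (ContDiff.comp hW ((contDiff_fst.prodMk contDiff_const).prodMk contDiff_snd)) s
      rw [logVel_flow_left] at this
      exact this)
    (fun s t => by
      have := hF.hasDerivAt_pairing (smoothFamily_flow (w s) ψ) t
      rw [logVel_flow] at this
      exact this) s 0
  simp only [Loop.flow_zero] at key
  have hds : ∀ x i, DifferentiableAt ℝ (fun r => logGrad δF (w r) x i) s := fun x i =>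
    (((hF.contDiff_logGrad hw i).comp (contDiff_id.prodMk contDiff_const :
      ContDiff ℝ ∞ fun r : ℝ => (r, x))).differentiable (by simp) s)
  have hdt : ∀ x i, DifferentiableAt ℝ (fun r => logGrad δF ((w s).flow ψ r) x i) 0 := fun x i =>
    (((hF.contDiff_logGrad (smoothFamily_flow (w s) ψ) i).comp (contDiff_id.prodMk contDiff_const :
      ContDiff ℝ ∞ fun r : ℝ => (r, x))).differentiable (by simp) 0)
  have e1 : ∀ x, deriv (fun r => ∑ i, logGrad δF (w r) x i * ψ.1 x i) s =
      ∑ i, deriv (fun r => logGrad δF (w r) x i) s * ψ.1 x i := fun x =>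
    (HasDerivAt.fun_sum fun i _ => (hds x i).hasDerivAt.mul_const _).deriv
  have e2 : ∀ x, deriv (fun r => ∑ i, logGrad δF ((w s).flow ψ r) x i * logVel w s x i) 0 =
      ∑ i, logHess δF ψ (w s) x i * logVel w s x i := fun x =>
    (HasDerivAt.fun_sum fun i _ => (hdt x i).hasDerivAt.mul_const _).deriv
  simp only [e1, e2] at key
  exact key

theorem IsVarDeriv.pairing_logHess_comm (hF : IsVarDeriv F δF) (u : Loop (nonzeroDomain 𝕜 N))
    (ψ φ : PeriodicField 𝕜 N) :
    pairing (logHess δF ψ u) φ.1 = pairing (logHess δF φ u) ψ.1 := by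
  have := hF.pairing_deriv_logGrad (smoothFamily_flow u φ) ψ 0
  rw [logVel_flow, Loop.flow_zero] at this
  exact this.symm

/-- The derivative of `logGrad δF` along a curve of loops, as a smooth periodic field. -/
def IsVarDeriv.gradVel (hF : IsVarDeriv F δF) {w : ℝ → Loop (nonzeroDomain 𝕜 N)}
    (hw : SmoothFamily w) (s : ℝ) : PeriodicField 𝕜 N :=
  ⟨fun x i => deriv (fun r => logGrad δF (w r) x i) s,
    contDiff_pi.2 fun i => (contDiff_deriv_fst (hF.contDiff_logGrad hw i)).comp
      (contDiff_prodMk_right s),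
    fun x => by
      have : ∀ r, logGrad δF (w r) (x + 1) = logGrad δF (w r) x :=
        fun r => (hF.gradField (w r)).2.2 x
      simp only [this]⟩

/-- The product rule on `∫ a_i η^{ij} ∂_x b_j` gives two terms; `pairing_op` moves the operator off
the varied `b`, and symmetry of the second variation then moves each derivative onto a fixed
direction, leaving a pairing with the velocity. -/
theorem hasDerivAt_bracket {M : ℕ} (hM : 0 < M) (hMN : M < N) (hF : IsVarDeriv F δF)
    (hG : IsVarDeriv G δG) {w : ℝ → Loop (nonzeroDomain 𝕜 N)} (hw : SmoothFamily w) (s : ℝ) :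
    HasDerivAt (fun r => bracket (laxMetric M) δF δG (w r))
      (pairing (logHess δF ((hG.gradField (w s)).op M) (w s)) (logVel w s) -
        pairing (logHess δG ((hF.gradField (w s)).op M) (w s)) (logVel w s)) s := by
  have ha := fun i => hF.contDiff_logGrad hw i
  have hb := fun i => hG.contDiff_logGrad hw i
  have hK : ContDiff ℝ ∞ fun q : ℝ × ℝ => ∑ i, logGrad δF (w q.1) q.2 i *
      ∑ j, logMetric 𝕜 N M i j * deriv (fun y => logGrad δG (w q.1) y j) q.2 :=
    ContDiff.sum fun i _ => (ha i).mul
      (ContDiff.sum fun j _ => contDiff_const.mul (contDiff_deriv_snd (hb j)))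
  have h := hasDerivAt_integral_of_contDiff hK s
  have e1 : (fun r => bracket (laxMetric M) δF δG (w r)) = fun r => ∫ x in (0 : ℝ)..1,
      ∑ i, logGrad δF (w r) x i *
        ∑ j, logMetric 𝕜 N M i j * deriv (fun y => logGrad δG (w r) y j) x :=
    funext fun r => bracket_eq_pairing hM hMN δF hG (w r)
  have e2 : ∀ x, deriv (fun r => ∑ i, logGrad δF (w r) x i *
        ∑ j, logMetric 𝕜 N M i j * deriv (fun y => logGrad δG (w r) y j) x) s =
      ∑ i, (hF.gradVel hw s).1 x i * ((hG.gradField (w s)).op M).1 x i +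
        ∑ i, (hF.gradField (w s)).1 x i * ((hG.gradVel hw s).op M).1 x i := by
    intro x
    rw [← Finset.sum_add_distrib]
    refine (HasDerivAt.fun_sum fun i _ => HasDerivAt.mul ?_ (HasDerivAt.fun_sum fun j _ =>
      (hasDerivAt_deriv_comm (hb j) s x).const_mul _)).deriv
    exact (((ha i).comp (contDiff_id.prodMk contDiff_const :
      ContDiff ℝ ∞ fun r : ℝ => (r, x))).differentiable (by simp) s).hasDerivAt
  rw [e1]
  convert h using 1
  simp only [e2]
  rw [intervalIntegral.integral_add (intervalIntegrable_pairing _ _)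
    (intervalIntegrable_pairing _ _), ← hF.pairing_deriv_logGrad hw, ← hG.pairing_deriv_logGrad hw]
  have h3 := pairing_op M (hF.gradField (w s)) (hG.gradVel hw s)
  rw [pairing_comm ((hF.gradField (w s)).op M).1] at h3
  rw [sub_eq_add_neg]
  exact congrArg₂ (· + ·) rfl h3.symm

/-! ### The Poisson bracket -/

/-- The variational derivative of the bracket of two functionals. -/
def bracketGrad (M : ℕ) (hF : IsVarDeriv F δF) (hG : IsVarDeriv G δG)
    (u : Loop (nonzeroDomain 𝕜 N)) (x : ℝ) (i : Fin N) : 𝕜 :=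
  (logHess δF ((hG.gradField u).op M) u x i - logHess δG ((hF.gradField u).op M) u x i) *
    (u.1 x i)⁻¹

theorem IsVarDeriv.periodic_logHess (hF : IsVarDeriv F δF) (ψ : PeriodicField 𝕜 N)
    (u : Loop (nonzeroDomain 𝕜 N)) : Function.Periodic (logHess δF ψ u) 1 := fun x => by
  have : ∀ t, logGrad δF (u.flow ψ t) (x + 1) = logGrad δF (u.flow ψ t) x :=
    fun t => (hF.gradField (u.flow ψ t)).2.2 x
  funext i
  simp only [logHess, this]

theorem IsVarDeriv.contDiff_logHess {E : Type*} [NormedAddCommGroup E] [NormedSpace ℝ E]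
    [FiniteDimensional ℝ E] (M : ℕ) (hF : IsVarDeriv F δF) (hG : IsVarDeriv G δG)
    {w : E → Loop (nonzeroDomain 𝕜 N)} (hw : SmoothFamily w) (i : Fin N) :
    ContDiff ℝ ∞ fun q : E × ℝ => logHess δF ((hG.gradField (w q.1)).op M) (w q.1) q.2 i := by
  have hψ : ContDiff ℝ ∞ fun q : E × ℝ => ((hG.gradField (w q.1)).op M).1 q.2 :=
    contDiff_pi.2 fun i => show ContDiff ℝ ∞ fun q : E × ℝ =>
        ∑ j, logMetric 𝕜 N M i j * deriv (fun y => logGrad δG (w q.1) y j) q.2 from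
      ContDiff.sum fun j _ => contDiff_const.mul (contDiff_deriv_snd (hG.contDiff_logGrad hw j))
  -- The direction of variation depends on the loop, so the flow time is adjoined to the parameters
  -- and the joint family is differentiated at time `0`.
  have hW := hF.contDiff_logGrad (hw.flow (ψ := fun q => (hG.gradField (w q)).op M) hψ) i
  have h1 := contDiff_deriv_fst (E := E × ℝ) (G := fun z : ℝ × (E × ℝ) =>
    logGrad δF ((w z.2.1).flow ((hG.gradField (w z.2.1)).op M) z.1) z.2.2 i)
    (hW.comp (((contDiff_fst.comp contDiff_snd).prodMk contDiff_fst).prodMk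
      (contDiff_snd.comp contDiff_snd)))
  exact h1.comp (contDiff_prodMk_right (0 : ℝ))

theorem intervalIntegrable_of_contDiff {f : ℝ → 𝕜} (hf : ContDiff ℝ ∞ f) :
    IntervalIntegrable f MeasureTheory.volume 0 1 := hf.continuous.intervalIntegrable _ _

theorem isVarDeriv_bracket {M : ℕ} (hM : 0 < M) (hMN : M < N) (hF : IsVarDeriv F δF)
    (hG : IsVarDeriv G δG) :
    IsVarDeriv (bracket (laxMetric M) δF δG) (bracketGrad M hF hG) where
  periodic u x := by
    funext i
    simp only [bracketGrad, hF.periodic_logHess _ u x, hG.periodic_logHess _ u x, u.2.2.1 x]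
  smooth m w hw := contDiff_pi.2 fun i =>
    ((hF.contDiff_logHess M hG hw i).sub (hG.contDiff_logHess M hF hw i)).mul
      ((contDiff_pi.1 hw i).inv fun q => (w q.1).2.2.2 q.2 i)
  variation w hw s := by
    convert hasDerivAt_bracket hM hMN hF hG hw s using 1
    have hl := fun i => (SmoothFamily.contDiff_logVel hw i).comp (contDiff_prodMk_right s)
    have h1 := fun i => (hF.contDiff_logHess M hG hw i).comp (contDiff_prodMk_right s)
    have h2 := fun i => (hG.contDiff_logHess M hF hw i).comp (contDiff_prodMk_right s)
    refine Eq.trans ?_ (intervalIntegral.integral_sub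
      (intervalIntegrable_of_contDiff (ContDiff.sum fun i _ => (h1 i).mul (hl i)))
      (intervalIntegrable_of_contDiff (ContDiff.sum fun i _ => (h2 i).mul (hl i))))
    refine congrArg (fun f : ℝ → 𝕜 => ∫ x in (0 : ℝ)..1, f x) (funext fun x => ?_)
    rw [← Finset.sum_sub_distrib]
    refine Finset.sum_congr rfl fun i _ => ?_
    simp only [bracketGrad, logVel]
    ring

/-- Bracketing with `H` differentiates along the flow in the direction `η ∂_x` of the gradient of
`H`. Hence any variational derivative `δFG` gives the value found by `hasDerivAt_bracket`, and no
explicit formula for it is needed. -/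
theorem bracket_bracket {M : ℕ} (hM : 0 < M) (hMN : M < N) (hF : IsVarDeriv F δF)
    (hG : IsVarDeriv G δG) (hH : IsVarDeriv H δH)
    {δFG : Loop (nonzeroDomain 𝕜 N) → ℝ → Fin N → 𝕜}
    (hFG : IsVarDeriv (bracket (laxMetric M) δF δG) δFG) (u : Loop (nonzeroDomain 𝕜 N)) :
    bracket (laxMetric M) δFG δH u =
      pairing (logHess δF ((hG.gradField u).op M) u) ((hH.gradField u).op M).1 -
        pairing (logHess δG ((hF.gradField u).op M) u) ((hH.gradField u).op M).1 := by
  have hw := smoothFamily_flow u ((hH.gradField u).op M)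
  have h1 := hFG.hasDerivAt_pairing hw 0
  have h2 := hasDerivAt_bracket hM hMN hF hG hw 0
  have h3 := h1.unique h2
  simp only [logVel_flow, Loop.flow_zero] at h3
  rw [bracket_eq_pairing hM hMN δFG hH, h3]

theorem isHamiltonianStructure_laxMetric {M : ℕ} (hM : 0 < M) (hMN : M < N) :
    IsHamiltonianStructure (laxMetric (𝕜 := 𝕜) (N := N) M) (nonzeroDomain 𝕜 N) where
  closed F G δF δG hF hG := ⟨_, isVarDeriv_bracket hM hMN hF hG⟩
  skew F G δF δG hF hG u := by
    rw [bracket_eq_pairing hM hMN δF hG, bracket_eq_pairing hM hMN δG hF,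
      pairing_comm (logGrad δG u)]
    exact pairing_op M (hF.gradField u) (hG.gradField u)
  jacobi F G H δF δG δH δFG δGH δHF hF hG hH hFG hGH hHF u := by
    -- The cyclic sum consists of six second variations, two for each functional, with opposite
    -- signs and interchanged arguments; they cancel by symmetry.
    rw [bracket_bracket hM hMN hF hG hH hFG, bracket_bracket hM hMN hG hH hF hGH,
      bracket_bracket hM hMN hH hF hG hHF, hF.pairing_logHess_comm u ((hH.gradField u).op M),
      hG.pairing_logHess_comm u ((hF.gradField u).op M),
      hH.pairing_logHess_comm u ((hG.gradField u).op M)]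
    ring

/-! ### The charges -/

theorem isVarDeriv_charge (M n : ℕ) (U : Set (Fin N → 𝕜)) :
    IsVarDeriv (U := U) (fun u => (n : 𝕜)⁻¹ * charge M n u) (fun u => chargeGrad M n u.1) := by
  have hQ : ContDiff 𝕜 ∞ (chargeDensity (𝕜 := 𝕜) (N := N) M n) := contDiff_powCoeff M n n
  refine ⟨fun u x => ?_, fun m w hw => ?_, fun w hw s => ?_⟩
  · funext j
    simp only [chargeGrad, u.2.2.1 x]
  · exact contDiff_pi.2 fun j =>
      contDiff_const.mul (((contDiff_pd hQ j).restrict_scalars ℝ).comp hw)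
  · have h : HasDerivAt (fun r => (n : 𝕜)⁻¹ * charge M n (w r)) _ s :=
      (hasDerivAt_integral_of_contDiff ((hQ.restrict_scalars ℝ).comp hw) s).const_mul (n : 𝕜)⁻¹
    refine h.congr_deriv (Eq.symm ?_)
    rw [← intervalIntegral.integral_const_mul]
    refine congrArg (fun f : ℝ → 𝕜 => ∫ x in (0 : ℝ)..1, f x) (funext fun x => ?_)
    have hx : DifferentiableAt ℝ (fun r => (w r).1 x) s :=
      (hw.comp (contDiff_id.prodMk contDiff_const :
        ContDiff ℝ ∞ fun r : ℝ => (r, x))).differentiable (by simp) s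
    have hd : HasDerivAt (fun r => chargeDensity M n ((w r).1 x)) _ s :=
      hasDerivAt_comp_of_differentiableAt (c := fun r => (w r).1 x)
        (hQ.differentiable (by simp) ((w s).1 x)) hx.hasDerivAt
    simp only [Function.comp_def]
    rw [hd.deriv, fderiv_apply_eq_sum_pd, Finset.mul_sum]
    refine Finset.sum_congr rfl fun j _ => ?_
    rw [← ((hasDerivAt_pi.1 hx.hasDerivAt) j).deriv, chargeGrad]
    ring

end DispersionlessLax

end

open DispersionlessLax
theorem proposition3 {𝕜 : Type*} [RCLike 𝕜] (N M : ℕ) (hM : 0 < M) (hMN : M < N) :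
    IsFlatMetric (laxMetric (𝕜 := 𝕜) (N := N) M) (nonzeroDomain 𝕜 N) ∧
    IsHamiltonianStructure (laxMetric (𝕜 := 𝕜) (N := N) M) (nonzeroDomain 𝕜 N) ∧
    ∀ n : ℕ, 1 ≤ n →
      IsVarDeriv (U := nonzeroDomain 𝕜 N) (fun u => (n : 𝕜)⁻¹ * charge M n u)
        (fun u => chargeGrad M n u.1) ∧
      ∀ (u : ℝ → ℝ → Fin N → 𝕜) (τ x : ℝ),
        (∀ σ y, u σ y ∈ nonzeroDomain 𝕜 N) →
        DifferentiableAt ℝ (fun σ => u σ x) τ →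
        DifferentiableAt ℝ (fun y => u τ y) x →
        (HamEqAt (laxMetric M) (chargeGrad M n) u τ x → LaxEqAt M n u τ x) ∧
        (Function.Injective (u τ x) →
          LaxEqAt M n u τ x → HamEqAt (laxMetric M) (chargeGrad M n) u τ x) :=
  ⟨isFlatMetric_laxMetric hM hMN, isHamiltonianStructure_laxMetric hM hMN, fun n hn =>
    ⟨isVarDeriv_charge M n _, fun _ τ x hu hτ hx =>
      ⟨laxEqAt_of_hamEqAt hM hMN hn (hu τ x) hτ hx,
        hamEqAt_of_laxEqAt hM hMN hn (hu τ x) hτ hx⟩⟩⟩
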